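/- \textbf{Lemma (LP rounding -- complete dictionary).} Setting: $\mathbf A_0\in\mathbb R^{n\times n}$ is invertible with condition number $\kappa(\mathbf A_0)=\|\mathbf A_0\|\,\|\mathbf A_0^{-1}\|$ (operator norms), $\mathbf X_0\in\mathbb R^{n\times p}$ is a random matrix whose entries are i.i.d. Bernoulli--Gaussian with rate $\theta$ (each is distributed as $B\cdot G$ with $B\sim\mathrm{Ber}(\theta)$ and $G\sim\mathcal N(0,1)$ independent), $\mathbf Y=\mathbf A_0\mathbf X_0$, and $\overline{\mathbf Y}=\sqrt{\theta p}\,(\mathbf Y\mathbf Y^*)^{-1/2}\mathbf Y$ is the preconditioned data. For a unit vector $\mathbf r\in\mathbb R^n$, the LP rounding is the linear program \[ \min_{\mathbf q\in\mathbb R^n}\ \|\mathbf q^*\overline{\mathbf Y}\|_1\quad\text{subject to}\quad \langle \mathbf r,\mathbf q\rangle=1 . \] A target for the $i$-th row $\mathbf x^i$ of $\mathbf X_0$ is a vector $\mathbf q_\star$ with $\mathbf q_\star^*\overline{\mathbf Y}=\alpha\,(\mathbf x^i)^*$ for some $\alpha\neq0$, normalized by $\|\mathbf q_\star\|=1$ or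 by $|\alpha|=1$ (either normalization is allowed). There is a numerical constant $c>0$, and for every constant $c_\star>0$ there is a constant $C>0$, such that the following holds for all $n$, $p$, all $\theta\in(0,1/3)$, all $\mu\in(0,1]$ and all invertible $\mathbf A_0$. If \[ p\ \ge\ \frac{C}{c_\star^2\,\theta}\,\max\Big\{\frac{n^4}{\mu^4},\frac{n^5}{\mu^2}\Big\}\,\kappa^8(\mathbf A_0)\,\log^4\!\Big(\frac{\kappa(\mathbf A_0)\,n}{\mu\theta}\Big), \] then with probability at least $1-c\,p^{-6}$ the matrix $\mathbf Y\mathbf Y^*$ is invertible, every row of $\mathbf X_0$ has a target, and, simultaneously for every row $i$, every target $\mathbf q_\star$ for row $i$ and every unit vector $\mathbf r$ with $\langle\mathbf r,\mathbf q_\star\rangle\ge 249/250$, the LP rounding returns $\mathbf q_\star$ up to the scaling forced by its constraint: its unique minimizer is $\mathbf q_\star/\langle\mathbf r,\mathbf q_\star\rangle$. -/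

import Mathlib

open MeasureTheory ProbabilityTheory Matrix

noncomputable section

namespace DictRecovery

/-- The Bernoulli-Gaussian law `BG(θ)`: the law of `B * G` with `B ∼ Ber(θ)` (values in `{0, 1}`)
and `G ∼ N(0, 1)` independent. -/
def bernoulliGaussian (θ : unitInterval) : Measure ℝ :=
  Measure.mconv (bernoulliMeasure (1 : ℝ) 0 θ) (gaussianReal 0 1)

/-- The entries of the random matrix `X` are independent and all have law `BG(θ)`. -/
def IsBernoulliGaussian {Ω : Type*} [MeasurableSpace Ω] (P : Measure Ω) {n p : ℕ}
    (θ : unitInterval) (X : Ω → Matrix (Fin n) (Fin p) ℝ) : Prop :=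
  iIndepFun (fun (ik : Fin n × Fin p) (ω : Ω) => X ω ik.1 ik.2) P ∧
    ∀ i k, HasLaw (fun ω => X ω i k) (bernoulliGaussian θ) P

/-- The condition number `‖A‖ * ‖A⁻¹‖` in the `ℓ² → ℓ²` operator norm (for invertible `A`). -/
def condNumber {n : ℕ} (A : Matrix (Fin n) (Fin n) ℝ) : ℝ :=
  ‖Matrix.toEuclideanCLM (𝕜 := ℝ) A‖ * ‖Matrix.toEuclideanCLM (𝕜 := ℝ) A⁻¹‖

/-- `S ^ (-1/2)` for a symmetric positive definite matrix `S`, by the functional calculus. -/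
def invSqrt {n : ℕ} (S : Matrix (Fin n) (Fin n) ℝ) : Matrix (Fin n) (Fin n) ℝ :=
  cfc (fun x : ℝ => (Real.sqrt x)⁻¹) S

/-- The preconditioned data `√(θ p) (Y Yᵀ)^(-1/2) Y`, meaningful when `Y Yᵀ` is invertible. -/
def precond {n p : ℕ} (θ : ℝ) (Y : Matrix (Fin n) (Fin p) ℝ) : Matrix (Fin n) (Fin p) ℝ :=
  Real.sqrt (θ * p) • (invSqrt (Y * Yᵀ) * Y)

/-- The LP objective `‖qᵀ Y‖₁`. -/
def lpObjective {n p : ℕ} (Y : Matrix (Fin n) (Fin p) ℝ) (q : EuclideanSpace ℝ (Fin n)) : ℝ :=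
  ∑ k, |(q.ofLp ᵥ* Y) k|

/-- The set of optimal solutions of the rounding LP
`minimize ‖qᵀ Y‖₁ subject to ⟨r, q⟩ = 1`. -/
def lpSolutions {n p : ℕ} (Y : Matrix (Fin n) (Fin p) ℝ) (r : EuclideanSpace ℝ (Fin n)) :
    Set (EuclideanSpace ℝ (Fin n)) :=
  {q | inner ℝ r q = 1 ∧ ∀ q', inner ℝ r q' = 1 → lpObjective Y q ≤ lpObjective Y q'}

/-- `q` is a target for the data `Y` and the `i`-th row of `X`: `qᵀ Y = α xⁱ` for some `α ≠ 0`,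
with either of the two usual normalizations, `‖q‖ = 1` or `α = ±1`. -/
def IsTarget {n p : ℕ} (Y X : Matrix (Fin n) (Fin p) ℝ) (i : Fin n)
    (q : EuclideanSpace ℝ (Fin n)) : Prop :=
  ∃ α : ℝ, α ≠ 0 ∧ q.ofLp ᵥ* Y = α • X i ∧ (‖q‖ = 1 ∨ |α| = 1)

end DictRecovery

end

noncomputable section

namespace DictRecovery

/-! ### Moments of the Bernoulli–Gaussian law -/

section

/-! Put `τ = θ p`. Preconditioning removes `A₀` exactly: the preconditioned data is `M X` with `M (X
Xᵀ) Mᵀ = τ I`, so conditioning of `A₀` does not enter the recovery argument. In the variable `z = Mᵀ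
q`, the program minimizes `‖zᵀ X‖₁` subject to `⟨u, z⟩ = 1` with `u = M⁻¹ r`, and a target for row
`i` becomes a multiple of `eᵢ`. Since `X Xᵀ` is close to `τ I`, `M` is nearly orthogonal, and `⟨r,
q⋆⟩ ≥ 249/250` forces the part of `u` off coordinate `i` to have norm at most `0.11 |uᵢ|`.

Write `z = zᵢ eᵢ + g` with `gᵢ = 0`. In each column, `|zᵢ xᵢ + g·x| ≥ |zᵢ||xᵢ| + σ(xᵢ) |g·x|`, where
`σ = zeroSign`. As `xᵢ` is independent of `g·x` and vanishes with probability `1 - θ > 2/3`, the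
last term has mean `(1 - 2θ) E|g·x| ≥ (3/20) θ ‖g‖`. The sum over columns gains about `0.15 τ ‖g‖`,
whereas the constraint lets `|zᵢ|` drop by at most `0.11 ‖g‖`, saving at most `0.121 τ ‖g‖`. Hence
`g = 0` at every minimizer (`GoodColumns.le_sum_abs`, `GoodColumns.lp_recovery`).

This uses only the deterministic conditions `GoodColumns`. They hold with high probability by a
Bernstein bound whose variance is of order `θ` (`SubexpMoment.measure_sum_ge_le`) and a union bound
over a grid of directions (`measure_not_goodColumns_le`). The failure probability is `exp(O(n²) - θ
p / O(n²))`, and the sample size makes it at most `p⁻⁶`. -/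

lemma bernoulliGaussian_eq (θ : unitInterval) :
    bernoulliGaussian θ = unitInterval.toNNReal θ • gaussianReal 0 1
      + unitInterval.toNNReal (unitInterval.symm θ) • Measure.dirac (0 : ℝ) := by
  have hs : ∀ (c : NNReal) (x : ℝ), Measure.map (fun y : ℝ × ℝ => y.1 * y.2)
      ((c • Measure.dirac x).prod (gaussianReal 0 1))
        = c • Measure.map (fun y => x * y) (gaussianReal 0 1) := by
    intro c x
    change Measure.map _ (((c : ENNReal) • Measure.dirac x).prod _) = (c : ENNReal) • _
    rw [Measure.prod_smul_left, Measure.map_smul, Measure.dirac_prod,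
      Measure.map_map (by fun_prop) (by fun_prop)]
    rfl
  rw [bernoulliGaussian, bernoulliMeasure_def, Measure.mconv, Measure.add_prod,
    Measure.map_add _ _ (by fun_prop), hs, hs]
  simp

instance (θ : unitInterval) : IsProbabilityMeasure (bernoulliGaussian θ) := by
  unfold bernoulliGaussian Measure.mconv
  exact Measure.isProbabilityMeasure_map (by fun_prop)

lemma integrable_bernoulliGaussian {E : Type*} [NormedAddCommGroup E] (θ : unitInterval)
    {f : ℝ → E} (hf : Integrable f (gaussianReal 0 1)) :
    Integrable f (bernoulliGaussian θ) := by
  rw [bernoulliGaussian_eq, integrable_add_measure]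
  exact ⟨hf.smul_measure_nnreal, (integrable_dirac (by simp)).smul_measure_nnreal⟩

lemma integral_bernoulliGaussian {E : Type*} [NormedAddCommGroup E] [NormedSpace ℝ E]
    [CompleteSpace E] (θ : unitInterval)
    {f : ℝ → E} (hf : Integrable f (gaussianReal 0 1)) :
    ∫ x, f x ∂(bernoulliGaussian θ)
      = (θ : ℝ) • ∫ x, f x ∂(gaussianReal 0 1) + (1 - (θ : ℝ)) • f 0 := by
  rw [bernoulliGaussian_eq, integral_add_measure hf.smul_measure_nnreal
    (integrable_dirac (by simp)).smul_measure_nnreal, integral_smul_nnreal_measure,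
    integral_smul_nnreal_measure, integral_dirac]
  rfl

lemma integrable_exp_sq_div_four :
    Integrable (fun x : ℝ => Real.exp (x ^ 2 / 4)) (gaussianReal 0 1) := by
  rw [gaussianReal_of_var_ne_zero _ one_ne_zero,
    integrable_withDensity_iff_integrable_smul' (by fun_prop) (by simp [gaussianPDF])]
  have : Integrable (fun x : ℝ => (Real.sqrt (2 * Real.pi))⁻¹ * Real.exp (-(1/4) * x ^ 2)) :=
    (integrable_exp_neg_mul_sq (by norm_num)).const_mul _
  refine this.congr (ae_of_all _ fun x => ?_)
  simp only [toReal_gaussianPDF, gaussianPDFReal, smul_eq_mul, mul_assoc, ← Real.exp_add]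
  congr 2
  · simp
  · simp; ring

lemma integral_exp_sq_div_four :
    ∫ x : ℝ, Real.exp (x ^ 2 / 4) ∂(gaussianReal 0 1) = Real.sqrt 2 := by
  rw [integral_gaussianReal_eq_integral_smul one_ne_zero]
  have : ∀ x : ℝ, gaussianPDFReal 0 1 x • Real.exp (x ^ 2 / 4)
      = (Real.sqrt (2 * Real.pi))⁻¹ * Real.exp (-(1/4) * x ^ 2) := by
    intro x
    simp only [gaussianPDFReal, smul_eq_mul, mul_assoc, ← Real.exp_add]
    congr 2
    · simp
    · simp; ring
  simp_rw [this]
  rw [integral_const_mul, integral_gaussian, ← Real.sqrt_inv, ← Real.sqrt_mul (by positivity)]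
  congr 1
  field_simp
  norm_num

lemma integrable_exp_mul (t : ℝ) :
    Integrable (fun x : ℝ => Real.exp (t * x)) (gaussianReal 0 1) :=
  integrable_exp_mul_gaussianReal t

lemma integrable_bernoulliGaussian_exp_mul (θ : unitInterval) (t : ℝ) :
    Integrable (fun x : ℝ => Real.exp (t * x)) (bernoulliGaussian θ) :=
  integrable_bernoulliGaussian θ (integrable_exp_mul t)

lemma integral_bernoulliGaussian_exp_mul (θ : unitInterval) (t : ℝ) :
    ∫ x : ℝ, Real.exp (t * x) ∂(bernoulliGaussian θ)
      = θ * Real.exp (t ^ 2 / 2) + (1 - θ) := by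
  rw [integral_bernoulliGaussian θ (integrable_exp_mul t)]
  have := congrFun (mgf_fun_id_gaussianReal (μ := 0) (v := 1)) t
  simp only [mgf] at this
  rw [this]
  simp

lemma integral_bernoulliGaussian_cexp (θ : unitInterval) (t : ℝ) :
    ∫ x : ℝ, Complex.exp (t * x * Complex.I) ∂(bernoulliGaussian θ)
      = ((θ * Real.exp (-t ^ 2 / 2) + (1 - θ) : ℝ) : ℂ) := by
  rw [integral_bernoulliGaussian θ]
  · have := charFun_gaussianReal (μ := 0) (v := 1) t
    rw [charFun_apply_real] at this
    rw [this]
    push_cast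
    simp [neg_div]
  · refine (integrable_const (1:ℝ)).mono' (by fun_prop) (ae_of_all _ fun x => ?_)
    rw [← Complex.ofReal_mul, Complex.norm_exp_ofReal_mul_I]

lemma integrable_sq_gaussianReal : Integrable (fun x : ℝ => x ^ 2) (gaussianReal 0 1) :=
  (memLp_id_gaussianReal 2).integrable_sq

lemma integral_sq_gaussianReal : ∫ x : ℝ, x ^ 2 ∂(gaussianReal 0 1) = 1 := by
  have := variance_fun_id_gaussianReal (μ := 0) (v := 1)
  rw [variance_of_integral_eq_zero (by fun_prop) (by simp)] at this
  simpa using this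

lemma integral_sq_bernoulliGaussian (θ : unitInterval) :
    ∫ x : ℝ, x ^ 2 ∂(bernoulliGaussian θ) = θ := by
  rw [integral_bernoulliGaussian θ integrable_sq_gaussianReal,
    integral_sq_gaussianReal]
  simp

lemma integrable_id_gaussianReal : Integrable (fun x : ℝ => x) (gaussianReal 0 1) :=
  (memLp_id_gaussianReal 1).integrable (by simp)

lemma integral_id_bernoulliGaussian (θ : unitInterval) :
    ∫ x : ℝ, x ∂(bernoulliGaussian θ) = 0 := by
  rw [integral_bernoulliGaussian θ integrable_id_gaussianReal]
  simp

lemma integral_abs_bernoulliGaussian_le (θ : unitInterval) :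
    ∫ x : ℝ, |x| ∂(bernoulliGaussian θ) ≤ θ := by
  rw [integral_bernoulliGaussian θ integrable_id_gaussianReal.abs]
  have h : ∫ x : ℝ, |x| ∂(gaussianReal 0 1) ≤ ∫ x : ℝ, (1 + x ^ 2) / 2 ∂(gaussianReal 0 1) := by
    refine integral_mono integrable_id_gaussianReal.abs
      (((integrable_const _).add integrable_sq_gaussianReal).div_const _) fun x => ?_
    have := sq_nonneg (|x| - 1)
    have := sq_abs x
    nlinarith
  rw [integral_div, integral_add (integrable_const _) integrable_sq_gaussianReal,
    integral_sq_gaussianReal] at h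
  have h2 : ∫ x : ℝ, |x| ∂(gaussianReal 0 1) ≤ 1 := by
    simpa using h
  rw [abs_zero, smul_zero, add_zero, smul_eq_mul]
  have := θ.2.1
  nlinarith

lemma integrable_bernoulliGaussian_exp_sq (θ : unitInterval) :
    Integrable (fun x : ℝ => Real.exp (x ^ 2 / 4) - 1) (bernoulliGaussian θ) :=
  (integrable_bernoulliGaussian θ integrable_exp_sq_div_four).sub (integrable_const _)

lemma integral_bernoulliGaussian_exp_sq_le (θ : unitInterval) :
    ∫ x : ℝ, (Real.exp (x ^ 2 / 4) - 1) ∂(bernoulliGaussian θ) ≤ θ := by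
  rw [integral_bernoulliGaussian (f := fun x : ℝ => Real.exp (x ^ 2 / 4) - 1) θ
    (integrable_exp_sq_div_four.sub (integrable_const _)), integral_sub integrable_exp_sq_div_four (integrable_const _), integral_exp_sq_div_four]
  have h : Real.sqrt 2 ≤ 2 := by
    rw [Real.sqrt_le_left (by norm_num)]; norm_num
  have := θ.2.1
  simp
  nlinarith

end

/-! ### Sub-exponential moments and Bernstein's inequality for columns -/

section

/-- The law of a column of a Bernoulli-Gaussian matrix. -/
def columnLaw (n : ℕ) (θ : unitInterval) : Measure (Fin n → ℝ) :=
  Measure.pi fun _ => bernoulliGaussian θ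

instance (n : ℕ) (θ : unitInterval) : IsProbabilityMeasure (columnLaw n θ) := by
  unfold columnLaw; infer_instance

variable {n : ℕ} {θ : unitInterval}

lemma measurePreserving_coord (i : Fin n) :
    MeasurePreserving (fun x : Fin n → ℝ => x i) (columnLaw n θ) (bernoulliGaussian θ) :=
  measurePreserving_eval _ i

lemma integral_coord (i : Fin n) {f : ℝ → ℝ} (hf : Measurable f) :
    ∫ x, f (x i) ∂(columnLaw n θ) = ∫ y, f y ∂(bernoulliGaussian θ) := by
  rw [← (measurePreserving_coord (θ := θ) i).map_eq,
    integral_map (measurable_pi_apply i).aemeasurable hf.aestronglyMeasurable]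

lemma integrable_coord (i : Fin n) {f : ℝ → ℝ} (hf : Integrable f (bernoulliGaussian θ)) :
    Integrable (fun x : Fin n → ℝ => f (x i)) (columnLaw n θ) :=
  (measurePreserving_coord (θ := θ) i).integrable_comp_of_integrable hf

lemma exp_dotProduct (h x : Fin n → ℝ) :
    Real.exp (h ⬝ᵥ x) = ∏ j, Real.exp (h j * x j) := by
  rw [dotProduct, Real.exp_sum]

lemma integrable_exp_dotProduct (h : Fin n → ℝ) :
    Integrable (fun x => Real.exp (h ⬝ᵥ x)) (columnLaw n θ) := by
  simp_rw [exp_dotProduct]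
  exact Integrable.fintype_prod (f := fun j y => Real.exp (h j * y)) fun j =>
    integrable_bernoulliGaussian_exp_mul θ (h j)

/-- The coordinate factors `θ exp(hⱼ²/2) + 1 - θ` are at most `exp(θ hⱼ²)`, and the exponents add up
to `θ`. The excess over `1` is therefore of order `θ`, uniformly in the dimension. -/
lemma integral_exp_dotProduct_le {h : Fin n → ℝ} (hh : ∑ j, h j ^ 2 = 1) :
    ∫ x, Real.exp (h ⬝ᵥ x) ∂(columnLaw n θ) ≤ 1 + 2 * θ := by
  simp_rw [exp_dotProduct]
  rw [columnLaw, integral_fintype_prod_eq_prod (f := fun j y => Real.exp (h j * y))]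
  simp_rw [integral_bernoulliGaussian_exp_mul]
  have h0 := θ.2.1
  have h1 := θ.2.2
  have key : ∀ y : ℝ, 0 ≤ y → y ≤ 1 → Real.exp y ≤ 1 + 2 * y := by
    intro y hy hy1
    have := Real.abs_exp_sub_one_le (x := y) (by rw [abs_of_nonneg hy]; exact hy1)
    rw [abs_of_nonneg hy] at this
    linarith [le_abs_self (Real.exp y - 1)]
  calc ∏ j, ((θ : ℝ) * Real.exp (h j ^ 2 / 2) + (1 - θ))
      ≤ ∏ j, Real.exp (θ * h j ^ 2) := by
        refine Finset.prod_le_prod (fun j _ => ?_) fun j _ => ?_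
        · have := Real.exp_pos (h j ^ 2 / 2)
          nlinarith
        · have hj : h j ^ 2 ≤ 1 := by
            rw [← hh]
            exact Finset.single_le_sum (f := fun j => h j ^ 2) (fun _ _ => sq_nonneg _)
              (Finset.mem_univ j)
          have := key (h j ^ 2 / 2) (by positivity) (by linarith)
          have := Real.add_one_le_exp (θ * h j ^ 2)
          nlinarith
    _ = Real.exp θ := by
        rw [← Real.exp_sum, ← Finset.mul_sum, hh, mul_one]
    _ ≤ _ := key _ h0 h1

lemma integrable_cosh_dotProduct (h : Fin n → ℝ) :
    Integrable (fun x => Real.cosh (h ⬝ᵥ x) - 1) (columnLaw n θ) := by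
  have h2 := integrable_exp_dotProduct (θ := θ) (-h)
  simp_rw [neg_dotProduct] at h2
  simp_rw [Real.cosh_eq]
  exact (((integrable_exp_dotProduct h).add h2).div_const 2).sub (integrable_const _)

lemma integral_cosh_dotProduct_le {h : Fin n → ℝ} (hh : ∑ j, h j ^ 2 = 1) :
    ∫ x, (Real.cosh (h ⬝ᵥ x) - 1) ∂(columnLaw n θ) ≤ 2 * θ := by
  have i2 := integrable_exp_dotProduct (θ := θ) (-h)
  have l2 := integral_exp_dotProduct_le (θ := θ) (h := -h) (by simpa using hh)
  simp_rw [neg_dotProduct] at i2 l2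
  simp_rw [Real.cosh_eq]
  have i3 : Integrable (fun x => (Real.exp (h ⬝ᵥ x) + Real.exp (-(h ⬝ᵥ x))) / 2)
      (columnLaw n θ) := ((integrable_exp_dotProduct h).add i2).div_const 2
  rw [integral_sub i3 (integrable_const _), integral_div,
    integral_add (integrable_exp_dotProduct h) i2]
  have := integral_exp_dotProduct_le (θ := θ) hh
  simp
  linarith

/-- With `|y| = 2u`, `cosh y - 1 = 2 sinh² u`, and `u exp(u/2) ≤ 4 sinh u`. Keeping the `-1` is
essential: it is what makes the resulting moment `O(θ)` instead of `O(1)`. -/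
lemma sq_mul_exp_le_cosh (y : ℝ) : y ^ 2 * Real.exp (|y| / 8) ≤ 32 * (Real.cosh y - 1) := by
  have h1 : y ^ 2 * Real.exp (|y| / 8) ≤ y ^ 2 * Real.exp (|y| / 2) := by
    gcongr
    norm_num
  refine h1.trans ?_
  rw [← Real.cosh_abs, ← sq_abs]
  obtain ⟨u, hu⟩ : ∃ u, |y| = 2 * u := ⟨|y| / 2, by ring⟩
  have hu0 : 0 ≤ u := by linarith [abs_nonneg y]
  rw [hu, Real.cosh_two_mul, Real.cosh_sq, show 2 * u / 2 = u by ring]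
  have e1 : Real.sinh u = Real.exp (u / 2) * (Real.exp (u / 2) - Real.exp (-(3 * u / 2))) / 2 := by
    rw [Real.sinh_eq, mul_sub, ← Real.exp_add, ← Real.exp_add]
    congr 3 <;> ring
  have e2 : Real.exp (-(3 * u / 2)) ≤ 1 := Real.exp_le_one_iff.2 (by linarith)
  have e3 := Real.add_one_le_exp (u / 2)
  have e4 : u * Real.exp (u / 2) ≤ 4 * Real.sinh u := by
    rw [e1]
    have := Real.exp_pos (u / 2)
    nlinarith
  have e5 : Real.exp u = Real.exp (u / 2) ^ 2 := by rw [sq, ← Real.exp_add]; ring_nf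
  have e6 : (u * Real.exp (u / 2)) ^ 2 ≤ (4 * Real.sinh u) ^ 2 := by
    gcongr
  rw [e5]
  nlinarith

lemma sq_mul_exp_le_exp {y : ℝ} (hy : 0 ≤ y) :
    y ^ 2 * Real.exp (y / 8) ≤ 256 * (Real.exp (y / 4) - 1) := by
  have e3 := Real.add_one_le_exp (y / 16)
  have e4 : Real.exp (y / 8) = Real.exp (y / 16) ^ 2 := by rw [sq, ← Real.exp_add]; ring_nf
  have e5 : Real.exp (y / 4) = Real.exp (y / 16) ^ 4 := by
    rw [← Real.exp_nat_mul]; push_cast; ring_nf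
  rw [e4, e5]
  set w := Real.exp (y / 16)
  have hw : 1 ≤ w := by linarith
  have h1 : y ^ 2 ≤ 256 * (w - 1) ^ 2 := by
    have : y ≤ 16 * (w - 1) := by linarith
    nlinarith
  have h2 : (w - 1) ^ 2 * w ^ 2 ≤ w ^ 4 - 1 := by
    nlinarith [mul_nonneg (sub_nonneg.2 hw) (sq_nonneg w), mul_nonneg (sub_nonneg.2 hw) (sub_nonneg.2 hw)]
  nlinarith [sq_nonneg w]

/-- The integrability condition behind a Bernstein bound at scale `θ`. -/
structure SubexpMoment (θ : unitInterval) (F : (Fin n → ℝ) → ℝ) : Prop where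
  measurable : Measurable F
  integrable : Integrable (fun x => F x ^ 2 * Real.exp (|F x| / 8)) (columnLaw n θ)
  integral_le : ∫ x, F x ^ 2 * Real.exp (|F x| / 8) ∂(columnLaw n θ) ≤ 512 * θ

lemma SubexpMoment.of_le {F : (Fin n → ℝ) → ℝ} {g : (Fin n → ℝ) → ℝ} (hF : Measurable F)
    (hg : Integrable g (columnLaw n θ)) (hFg : ∀ x, F x ^ 2 * Real.exp (|F x| / 8) ≤ g x)
    (hi : ∫ x, g x ∂(columnLaw n θ) ≤ 512 * θ) : SubexpMoment θ F := by
  have : Integrable (fun x => F x ^ 2 * Real.exp (|F x| / 8)) (columnLaw n θ) := by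
    refine hg.mono' (Measurable.aestronglyMeasurable (by fun_prop)) (ae_of_all _ fun x => ?_)
    rw [Real.norm_of_nonneg (by positivity)]
    exact hFg x
  exact ⟨hF, this, (integral_mono this hg hFg).trans hi⟩

lemma SubexpMoment.neg {F : (Fin n → ℝ) → ℝ} (h : SubexpMoment θ F) :
    SubexpMoment θ fun x => -F x := by
  obtain ⟨h1, h2, h3⟩ := h
  exact ⟨h1.neg, by simpa using h2, by simpa using h3⟩

/-- Only the modulus of `F` enters the moment, so this covers `|h ⬝ᵥ x|` and its signed version
alike. -/
lemma SubexpMoment.of_abs_eq_dotProduct {F : (Fin n → ℝ) → ℝ} (hF : Measurable F)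
    {h : Fin n → ℝ} (hh : ∑ j, h j ^ 2 = 1) (hFh : ∀ x, |F x| = |h ⬝ᵥ x|) :
    SubexpMoment θ F := by
  refine .of_le hF ((integrable_cosh_dotProduct h).const_mul 32) (fun x => ?_) ?_
  · rw [← sq_abs, hFh, sq_abs]
    exact sq_mul_exp_le_cosh _
  · rw [integral_const_mul]
    have := integral_cosh_dotProduct_le (θ := θ) hh
    have := θ.2.1
    linarith

/-- Bounding `|xᵢ xⱼ|` by the larger square reduces to one coordinate and treats `i = j` and `i ≠ j`
together. The two squares contribute `256 θ` each, whence the `512` in `SubexpMoment`. -/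
lemma SubexpMoment.mul_coord (i j : Fin n) :
    SubexpMoment θ fun x : Fin n → ℝ => x i * x j := by
  have hi := fun i : Fin n => integrable_coord i (integrable_bernoulliGaussian_exp_sq θ)
  refine .of_le (g := fun x => 256 * (Real.exp (x i ^ 2 / 4) - 1)
    + 256 * (Real.exp (x j ^ 2 / 4) - 1)) (by fun_prop)
    (((hi i).const_mul 256).add ((hi j).const_mul 256)) (fun x => ?_) ?_
  · have hx : |x i * x j| ≤ max (x i ^ 2) (x j ^ 2) := by
      rw [abs_mul, ← sq_abs (x i), ← sq_abs (x j)]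
      rcases le_total |x i| |x j| with h | h
      · exact le_max_of_le_right (by nlinarith [abs_nonneg (x i)])
      · exact le_max_of_le_left (by nlinarith [abs_nonneg (x j)])
    have hp : ∀ y : ℝ, 0 ≤ 256 * (Real.exp (y ^ 2 / 4) - 1) := fun y => by
      have := Real.add_one_le_exp (y ^ 2 / 4)
      nlinarith [sq_nonneg y]
    calc (x i * x j) ^ 2 * Real.exp (|x i * x j| / 8)
        ≤ max (x i ^ 2) (x j ^ 2) ^ 2 * Real.exp (max (x i ^ 2) (x j ^ 2) / 8) := by
          rw [← sq_abs (x i * x j)]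
          gcongr
      _ ≤ _ := by
          rcases max_choice (x i ^ 2) (x j ^ 2) with h | h <;> rw [h]
          · linarith [sq_mul_exp_le_exp (sq_nonneg (x i)), hp (x j)]
          · linarith [sq_mul_exp_le_exp (sq_nonneg (x j)), hp (x i)]
  · rw [integral_add ((hi i).const_mul 256) ((hi j).const_mul 256), integral_const_mul,
      integral_const_mul,
      integral_coord i (f := fun y => Real.exp (y ^ 2 / 4) - 1) (by fun_prop),
      integral_coord j (f := fun y => Real.exp (y ^ 2 / 4) - 1) (by fun_prop)]
    linarith [integral_bernoulliGaussian_exp_sq_le θ]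

lemma SubexpMoment.integrable_self {F : (Fin n → ℝ) → ℝ} (h : SubexpMoment θ F) :
    Integrable F (columnLaw n θ) := by
  refine ((integrable_const (1 : ℝ)).add h.integrable).mono' h.measurable.aestronglyMeasurable
    (ae_of_all _ fun x => ?_)
  have : 1 ≤ Real.exp (|F x| / 8) := Real.one_le_exp (by positivity)
  rw [Real.norm_eq_abs]
  simp only [Pi.add_apply]
  have h2 := sq_abs (F x)
  nlinarith [sq_nonneg (|F x| - 1), sq_nonneg (F x)]

lemma exp_le_one_add_add (y : ℝ) : Real.exp y ≤ 1 + y + y ^ 2 * Real.exp |y| := by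
  have := Complex.norm_exp_sub_sum_le_norm_mul_exp (y : ℂ) 2
  have e : Complex.exp y - ∑ m ∈ Finset.range 2, (y : ℂ) ^ m / (m.factorial : ℂ)
      = ((Real.exp y - (1 + y) : ℝ) : ℂ) := by
    simp [Finset.sum_range_succ]
  rw [e, Complex.norm_real, Complex.norm_real, Real.norm_eq_abs, Real.norm_eq_abs, sq_abs] at this
  linarith [le_abs_self (Real.exp y - (1 + y))]

lemma SubexpMoment.exp_le {F : (Fin n → ℝ) → ℝ} {l : ℝ} (hl : 0 ≤ l) (hl' : l ≤ 1 / 8)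
    (x : Fin n → ℝ) :
    Real.exp (l * F x) ≤ 1 + l * F x + l ^ 2 * (F x ^ 2 * Real.exp (|F x| / 8)) := by
  refine (exp_le_one_add_add _).trans ?_
  rw [mul_pow, mul_assoc, abs_mul, abs_of_nonneg hl]
  gcongr
  nlinarith [abs_nonneg (F x)]

lemma SubexpMoment.integrable_bound {F : (Fin n → ℝ) → ℝ} (h : SubexpMoment θ F) (l : ℝ) :
    Integrable (fun x => 1 + l * F x + l ^ 2 * (F x ^ 2 * Real.exp (|F x| / 8)))
      (columnLaw n θ) :=
  ((integrable_const _).add (h.integrable_self.const_mul l)).add (h.integrable.const_mul _)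

lemma SubexpMoment.integrable_exp {F : (Fin n → ℝ) → ℝ} (h : SubexpMoment θ F) {l : ℝ}
    (hl : 0 ≤ l) (hl' : l ≤ 1 / 8) :
    Integrable (fun x => Real.exp (l * F x)) (columnLaw n θ) := by
  have := h.measurable
  refine (h.integrable_bound l).mono' (Measurable.aestronglyMeasurable (by fun_prop))
    (ae_of_all _ fun x => ?_)
  rw [Real.norm_of_nonneg (Real.exp_pos _).le]
  exact SubexpMoment.exp_le hl hl' x

lemma SubexpMoment.integral_exp_le {F : (Fin n → ℝ) → ℝ} (h : SubexpMoment θ F) {l : ℝ}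
    (hl : 0 ≤ l) (hl' : l ≤ 1 / 8) :
    ∫ x, Real.exp (l * F x) ∂(columnLaw n θ)
      ≤ Real.exp (l * ∫ x, F x ∂(columnLaw n θ) + l ^ 2 * (512 * θ)) := by
  refine (integral_mono (h.integrable_exp hl hl') (h.integrable_bound l)
    (SubexpMoment.exp_le hl hl')).trans ?_
  have i1 : Integrable (fun x => 1 + l * F x) (columnLaw n θ) :=
    (integrable_const _).add (h.integrable_self.const_mul l)
  rw [integral_add i1 (h.integrable.const_mul _), integral_add (integrable_const _) (h.integrable_self.const_mul l),
    integral_const_mul, integral_const_mul]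
  have h3 := mul_le_mul_of_nonneg_left h.integral_le (sq_nonneg l)
  have := Real.add_one_le_exp (l * ∫ x, F x ∂(columnLaw n θ) + l ^ 2 * (512 * θ))
  simp
  linarith

/-- The law of the columns of a Bernoulli-Gaussian matrix. -/
def columnsLaw (n p : ℕ) (θ : unitInterval) : Measure (Fin p → Fin n → ℝ) :=
  Measure.pi fun _ => columnLaw n θ

instance (n p : ℕ) (θ : unitInterval) : IsProbabilityMeasure (columnsLaw n p θ) := by
  unfold columnsLaw; infer_instance

/-- Bernstein's inequality for a sum over the columns. -/
lemma SubexpMoment.measure_sum_ge_le {p : ℕ} {F : (Fin n → ℝ) → ℝ} (h : SubexpMoment θ F)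
    {ε m : ℝ} (hε : 0 ≤ ε) (hε1 : ε ≤ 1) (hm : ∫ x, F x ∂(columnLaw n θ) ≤ m) :
    (columnsLaw n p θ).real {x | p * m + ε * (θ * p) ≤ ∑ k, F (x k)}
      ≤ Real.exp (-(ε ^ 2 * (θ * p) / 2048)) := by
  -- This minimizes the exponent `-l ε θ p + 512 l² θ p`, with value `-ε² θ p / 2048`.
  set l : ℝ := ε / 1024
  have hl : 0 ≤ l := by positivity
  have hl' : l ≤ 1 / 8 := by simp only [l]; linarith
  have hexp : ∀ x : Fin p → Fin n → ℝ,
      Real.exp (l * ∑ k, F (x k)) = ∏ k, Real.exp (l * F (x k)) := fun x => by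
    rw [Finset.mul_sum, Real.exp_sum]
  have hint : Integrable (fun x : Fin p → Fin n → ℝ => Real.exp (l * ∑ k, F (x k)))
      (columnsLaw n p θ) := by
    simp_rw [hexp]
    exact Integrable.fintype_prod (f := fun _ y => Real.exp (l * F y)) fun _ =>
      h.integrable_exp hl hl'
  refine (measure_ge_le_exp_mul_mgf _ hl hint).trans ?_
  have hmgf : mgf (fun x : Fin p → Fin n → ℝ => ∑ k, F (x k)) (columnsLaw n p θ) l
      = (∫ x, Real.exp (l * F x) ∂(columnLaw n θ)) ^ p := by
    simp only [mgf, hexp]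
    rw [columnsLaw, integral_fintype_prod_eq_prod (f := fun _ y => Real.exp (l * F y))]
    simp
  rw [hmgf]
  have h1 : (∫ x, Real.exp (l * F x) ∂(columnLaw n θ)) ^ p
      ≤ Real.exp (l * m + l ^ 2 * (512 * θ)) ^ p := by
    have h0 : 0 ≤ ∫ x, Real.exp (l * F x) ∂(columnLaw n θ) := by positivity
    refine pow_le_pow_left₀ h0 ((h.integral_exp_le hl hl').trans ?_) p
    gcongr
  rw [← Real.exp_nat_mul] at h1
  refine (mul_le_mul_of_nonneg_left h1 (Real.exp_pos _).le).trans ?_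
  rw [← Real.exp_add]
  apply Real.exp_le_exp.2
  simp only [l]
  apply le_of_eq
  ring

end

/-! ### Means of the column statistics, and the law of the columns -/

section

variable {n : ℕ} {θ : unitInterval}

lemma iIndepFun_coord : iIndepFun (fun (i : Fin n) (x : Fin n → ℝ) => x i) (columnLaw n θ) :=
  iIndepFun_pi (X := fun _ => id) fun _ => aemeasurable_id

lemma integral_mul_coord (i j : Fin n) :
    ∫ x, x i * x j ∂(columnLaw n θ) = if i = j then (θ : ℝ) else 0 := by
  split_ifs with h
  · subst h
    simp_rw [← sq]
    rw [integral_coord i (f := fun y => y ^ 2) (by fun_prop), integral_sq_bernoulliGaussian]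
  · rw [(iIndepFun_coord.indepFun h).integral_fun_mul_eq_mul_integral
      (measurable_pi_apply i).aestronglyMeasurable (measurable_pi_apply j).aestronglyMeasurable,
      integral_coord i (f := fun y => y) measurable_id, integral_id_bernoulliGaussian, zero_mul]

lemma integral_abs_coord_le (i : Fin n) : ∫ x, |x i| ∂(columnLaw n θ) ≤ θ := by
  rw [integral_coord i (f := fun y => |y|) (by fun_prop)]
  exact integral_abs_bernoulliGaussian_le θ

/-- Independent Bernoulli switches are compared with one shared switch. Adding a factor `a` to a
product `b` costs `t (1 - t) (1 - a) (1 - b) ≥ 0`. -/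
lemma prod_mixture_le {ι : Type*} (s : Finset ι) (a : ι → ℝ) (ha : ∀ i, 0 ≤ a i)
    (ha1 : ∀ i, a i ≤ 1) {t : ℝ} (ht : 0 ≤ t) (ht1 : t ≤ 1) :
    ∏ i ∈ s, (t * a i + (1 - t)) ≤ t * ∏ i ∈ s, a i + (1 - t) := by
  classical
  induction s using Finset.induction_on with
  | empty => simp
  | insert i s hi ih =>
    rw [Finset.prod_insert hi, Finset.prod_insert hi]
    have h0 : 0 ≤ t * a i + (1 - t) := by nlinarith [ha i]
    refine (mul_le_mul_of_nonneg_left ih h0).trans ?_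
    have h1 : ∏ i ∈ s, a i ≤ 1 := Finset.prod_le_one (fun i _ => ha i) fun i _ => ha1 i
    have := mul_nonneg (mul_nonneg ht (sub_nonneg.2 ht1))
      (mul_nonneg (sub_nonneg.2 (ha1 i)) (sub_nonneg.2 h1))
    nlinarith

/-- The characteristic function is a product of mixtures; sharing the switch turns it into that of a
single Bernoulli–Gaussian variable, since the Gaussian exponents sum to `-t²/2`. -/
lemma integral_cos_dotProduct_le {h : Fin n → ℝ} (hh : ∑ j, h j ^ 2 = 1) (t : ℝ) :
    ∫ x, Real.cos (t * (h ⬝ᵥ x)) ∂(columnLaw n θ)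
      ≤ θ * Real.exp (-t ^ 2 / 2) + (1 - θ) := by
  have e1 : ∀ x : Fin n → ℝ, Complex.exp ((t * (h ⬝ᵥ x) : ℝ) * Complex.I)
      = ∏ j, Complex.exp ((t * h j : ℝ) * x j * Complex.I) := fun x => by
    rw [← Complex.exp_sum, dotProduct, Finset.mul_sum]
    push_cast
    rw [Finset.sum_mul]
    congr 1
    refine Finset.sum_congr rfl fun j _ => by ring
  have hint : Integrable (fun x : Fin n → ℝ => Complex.exp ((t * (h ⬝ᵥ x) : ℝ) * Complex.I))
      (columnLaw n θ) := by
    refine (integrable_const (1 : ℝ)).mono' (Measurable.aestronglyMeasurable ?_)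
      (ae_of_all _ fun x => by rw [Complex.norm_exp_ofReal_mul_I])
    unfold dotProduct
    fun_prop
  have e2 : ∫ x, Complex.exp ((t * (h ⬝ᵥ x) : ℝ) * Complex.I) ∂(columnLaw n θ)
      = ((∏ j, (θ * Real.exp (-(t * h j) ^ 2 / 2) + (1 - θ)) : ℝ) : ℂ) := by
    simp_rw [e1]
    rw [columnLaw, integral_fintype_prod_eq_prod
      (f := fun j (y : ℝ) => Complex.exp ((t * h j : ℝ) * y * Complex.I))]
    simp_rw [integral_bernoulliGaussian_cexp]
    push_cast
    rfl
  have e3 : ∫ x, Real.cos (t * (h ⬝ᵥ x)) ∂(columnLaw n θ)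
      = ∏ j, (θ * Real.exp (-(t * h j) ^ 2 / 2) + (1 - θ)) := by
    have := Complex.reCLM.integral_comp_comm hint
    rw [e2] at this
    simpa [Complex.exp_ofReal_mul_I_re, -Complex.ofReal_prod, -Complex.ofReal_mul] using this
  rw [e3]
  refine (prod_mixture_le _ _ (fun j => (Real.exp_pos _).le)
    (fun j => Real.exp_le_one_iff.2 (by nlinarith [sq_nonneg (t * h j)])) θ.2.1 θ.2.2).trans ?_
  rw [← Real.exp_sum]
  apply le_of_eq
  congr 3
  rw [← Finset.sum_div, Finset.sum_neg_distrib]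
  simp_rw [mul_pow]
  rw [← Finset.mul_sum, hh, mul_one]

lemma one_sub_cos_le_abs (y : ℝ) : 1 - Real.cos y ≤ |y| := by
  have h1 := Real.one_sub_sq_div_two_le_cos (x := y)
  have h2 := Real.neg_one_le_cos y
  rcases le_total |y| 2 with h | h
  · rw [← sq_abs] at h1
    nlinarith [abs_nonneg y]
  · linarith

lemma exp_neg_nine_eighths_le : Real.exp (-(3 / 2 : ℝ) ^ 2 / 2) ≤ 13 / 40 := by
  have h : (40 / 13 : ℝ) ≤ Real.exp (9 / 8) := by
    have := Real.sum_le_exp_of_nonneg (x := 9 / 8) (by norm_num) 7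
    refine le_trans ?_ this
    norm_num [Finset.sum_range_succ, Nat.factorial]
  rw [show -(3 / 2 : ℝ) ^ 2 / 2 = -(9 / 8) by norm_num, Real.exp_neg]
  exact (inv_anti₀ (by norm_num) h).trans (by norm_num)

lemma measurable_dotProduct (h : Fin n → ℝ) : Measurable fun x : Fin n → ℝ => h ⬝ᵥ x := by
  unfold dotProduct
  fun_prop

lemma SubexpMoment.abs_dotProduct {h : Fin n → ℝ} (hh : ∑ j, h j ^ 2 = 1) :
    SubexpMoment θ fun x => |h ⬝ᵥ x| :=
  .of_abs_eq_dotProduct (measurable_dotProduct h).norm hh fun _ => abs_abs _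

/-- From `|y| ≥ 1 - cos y` at `y = (3/2) h·x`, the mean is at least `(2/3) (1 - e^(-9/8)) θ`, and
`(2/3)(1 - 13/40) = 9/20`. -/
lemma le_integral_abs_dotProduct {h : Fin n → ℝ} (hh : ∑ j, h j ^ 2 = 1) :
    9 / 20 * (θ : ℝ) ≤ ∫ x, |h ⬝ᵥ x| ∂(columnLaw n θ) := by
  have hcos : Integrable (fun x => Real.cos (3 / 2 * (h ⬝ᵥ x))) (columnLaw n θ) := by
    refine (integrable_const (1 : ℝ)).mono'
      (Real.measurable_cos.comp ((measurable_dotProduct h).const_mul _)).aestronglyMeasurable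
      (ae_of_all _ fun x => Real.abs_cos_le_one _)
  have h1 : ∫ x, (1 - Real.cos (3 / 2 * (h ⬝ᵥ x))) ∂(columnLaw n θ)
      ≤ ∫ x, 3 / 2 * |h ⬝ᵥ x| ∂(columnLaw n θ) := by
    refine integral_mono ((integrable_const _).sub hcos)
      ((SubexpMoment.abs_dotProduct hh).integrable_self.const_mul _) fun x => ?_
    refine (one_sub_cos_le_abs _).trans_eq ?_
    rw [abs_mul]
    norm_num
  rw [integral_const_mul, integral_sub (integrable_const _) hcos] at h1
  have h2 := integral_cos_dotProduct_le (θ := θ) hh (3 / 2)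
  have h3 := exp_neg_nine_eighths_le
  have h0 := θ.2.1
  simp at h1
  nlinarith

/-- `1` at zero and `-1` elsewhere. -/
def zeroSign (y : ℝ) : ℝ := if y = 0 then 1 else -1

lemma measurable_zeroSign : Measurable zeroSign :=
  Measurable.ite (measurableSet_singleton 0) measurable_const measurable_const

lemma abs_zeroSign (y : ℝ) : |zeroSign y| = 1 := by
  unfold zeroSign; split_ifs <;> simp

lemma integral_zeroSign : ∫ y, zeroSign y ∂(bernoulliGaussian θ) = 1 - 2 * θ := by
  rw [integral_bernoulliGaussian]
  · have : ∫ y, zeroSign y ∂(gaussianReal 0 1) = ∫ y, (-1 : ℝ) ∂(gaussianReal 0 1) := by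
      have := nullSingletonClass_gaussianReal (μ := 0) (v := 1) one_ne_zero
      refine integral_congr_ae ?_
      filter_upwards [measure_eq_zero_iff_ae_notMem.1
        (measure_singleton (μ := gaussianReal 0 1) (0 : ℝ))] with y hy
      exact if_neg hy
    rw [this]
    simp [zeroSign]
    ring
  · refine (integrable_const (1 : ℝ)).mono' measurable_zeroSign.aestronglyMeasurable
      (ae_of_all _ fun x => (abs_zeroSign x).le)

lemma SubexpMoment.zeroSign_mul (i : Fin n) {h : Fin n → ℝ} (hh : ∑ j, h j ^ 2 = 1) :
    SubexpMoment θ fun x => zeroSign (x i) * |h ⬝ᵥ x| :=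
  .of_abs_eq_dotProduct ((measurable_zeroSign.comp (measurable_pi_apply i)).mul
    (measurable_dotProduct h).norm) hh fun x => by rw [abs_mul, abs_zeroSign, abs_abs, one_mul]

/-- Since `h i = 0`, the product `h ⬝ᵥ x` involves only the other coordinates and is independent of
`x i`. -/
lemma integral_zeroSign_mul {i : Fin n} {h : Fin n → ℝ} (hi : h i = 0) :
    ∫ x, zeroSign (x i) * |h ⬝ᵥ x| ∂(columnLaw n θ)
      = (1 - 2 * θ) * ∫ x, |h ⬝ᵥ x| ∂(columnLaw n θ) := by
  have hind := (iIndepFun_coord (θ := θ)).indepFun_finset {i} ({i}ᶜ : Finset (Fin n))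
    (Finset.disjoint_singleton_left.2 (by simp)) measurable_pi_apply
  have hind2 := hind.comp (φ := fun y : ({i} : Finset (Fin n)) → ℝ => zeroSign (y ⟨i, by simp⟩))
    (ψ := fun y : (({i}ᶜ : Finset (Fin n))) → ℝ => |∑ j : ({i}ᶜ : Finset (Fin n)), h j * y j|)
    (measurable_zeroSign.comp (measurable_pi_apply _)) (by fun_prop)
  have hdot : ∀ x : Fin n → ℝ, h ⬝ᵥ x = ∑ j : ({i}ᶜ : Finset (Fin n)), h j * x j := fun x => by
    rw [Finset.sum_coe_sort ({i}ᶜ : Finset (Fin n)) fun j => h j * x j, dotProduct,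
      ← Finset.sum_add_sum_compl {i}]
    simp [hi]
  have := hind2.integral_fun_mul_eq_mul_integral
    (measurable_zeroSign.comp (measurable_pi_apply i)).aestronglyMeasurable
    (Measurable.aestronglyMeasurable (by fun_prop))
  simp only [Function.comp_apply, ← hdot] at this
  rw [this, integral_coord i measurable_zeroSign, integral_zeroSign]

lemma le_integral_zeroSign_mul (hθ : (θ : ℝ) < 1 / 3) {i : Fin n} {h : Fin n → ℝ} (hi : h i = 0)
    (hh : ∑ j, h j ^ 2 = 1) :
    3 / 20 * (θ : ℝ) ≤ ∫ x, zeroSign (x i) * |h ⬝ᵥ x| ∂(columnLaw n θ) := by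
  rw [integral_zeroSign_mul hi]
  have := le_integral_abs_dotProduct (θ := θ) hh
  have := θ.2.1
  nlinarith

/-- The columns of a Bernoulli-Gaussian matrix are independent with law `columnLaw`. -/
lemma IsBernoulliGaussian.hasLaw {Ω : Type*} [MeasurableSpace Ω] {P : Measure Ω}
    {p : ℕ} {X : Ω → Matrix (Fin n) (Fin p) ℝ} (hX : IsBernoulliGaussian P θ X) :
    HasLaw (fun ω k i => X ω i k) (columnsLaw n p θ) P := by
  have h1 : HasLaw (fun ω (q : Fin n × Fin p) => X ω q.1 q.2)
      (Measure.pi fun _ => bernoulliGaussian θ) P :=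
    hX.1.hasLaw_pi fun q => hX.2 q.1 q.2
  -- The nested product law, once flattened, is the law of the matrix entries; currying back then
  -- identifies the law of the columns.
  have h2 : HasLaw (fun (x : Fin p → Fin n → ℝ) (q : Fin n × Fin p) => x q.2 q.1)
      (Measure.pi fun _ => bernoulliGaussian θ) (columnsLaw n p θ) := by
    have hk : ∀ k : Fin p, MeasurePreserving (fun x : Fin p → Fin n → ℝ => x k)
        (columnsLaw n p θ) (columnLaw n θ) := fun k => measurePreserving_eval _ k
    have hi : iIndepFun (fun (q : Fin p × Fin n) (x : Fin p → Fin n → ℝ) => x q.1 q.2)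
        (columnsLaw n p θ) := by
      refine iIndepFun_uncurry' (X := fun (k : Fin p) (i : Fin n) (x : Fin p → Fin n → ℝ) => x k i)
        (fun k i => by fun_prop)
        (iIndepFun_pi (X := fun _ => id) fun _ => aemeasurable_id) fun k => ?_
      rw [iIndepFun_iff_map_fun_eq_pi_map fun i => Measurable.aemeasurable (by fun_prop)]
      have : ∀ i, (columnsLaw n p θ).map (fun x => x k i) = bernoulliGaussian θ := fun i =>
        ((measurePreserving_coord i).comp (hk k)).map_eq
      simp_rw [this]
      exact (hk k).map_eq
    refine (hi.precomp Prod.swap_injective).hasLaw_pi fun q => ?_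
    have := (measurePreserving_coord (θ := θ) q.1).comp (hk q.2)
    exact ⟨this.measurable.aemeasurable, this.map_eq⟩
  have hm : Measurable fun (y : Fin n × Fin p → ℝ) (k : Fin p) (i : Fin n) => y (i, k) := by
    fun_prop
  refine ⟨hm.comp_aemeasurable h1.aemeasurable, ?_⟩
  change P.map ((fun (y : Fin n × Fin p → ℝ) (k : Fin p) (i : Fin n) => y (i, k)) ∘
    fun ω (q : Fin n × Fin p) => X ω q.1 q.2) = _
  rw [← AEMeasurable.map_map_of_aemeasurable hm.aemeasurable h1.aemeasurable, h1.map_eq,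
    ← h2.map_eq, AEMeasurable.map_map_of_aemeasurable hm.aemeasurable h2.aemeasurable]
  exact Measure.map_id

end

/-! ### Regularity of the columns with high probability -/

section

variable {n : ℕ} {θ : unitInterval}

/-- The regularity of the columns `x k` on which the rounding analysis rests; `τ` is the expected
squared norm of a row. -/
structure GoodColumns {p : ℕ} (τ : ℝ) (x : Fin p → Fin n → ℝ) : Prop where
  gram : ∀ i j, |∑ k, x k i * x k j - if i = j then τ else 0| ≤ τ / (1000 * n)
  row_l1 : ∀ i, ∑ k, |x k i| ≤ 11 / 10 * τ
  sign : ∀ i g, g i = 0 →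
    7 / 50 * τ * √(∑ j, g j ^ 2) ≤ ∑ k, zeroSign (x k i) * |g ⬝ᵥ x k|

/-- The integer vectors with entries of modulus at most `1000 n`. -/
def integerGrid (n : ℕ) : Finset (Fin n → ℤ) :=
  Fintype.piFinset fun _ => Finset.Icc (-(1000 * n : ℤ)) (1000 * n)

lemma card_integerGrid : (integerGrid n).card = (2000 * n + 1) ^ n := by
  rw [integerGrid, Fintype.card_piFinset]
  simp
  congr 1
  omega

lemma sum_zeroSign_sub_le {p : ℕ} {τ : ℝ} {x : Fin p → Fin n → ℝ}
    (hl1 : ∀ i, ∑ k, |x k i| ≤ 11 / 10 * τ) (i : Fin n) (g g' : Fin n → ℝ) {δ : ℝ}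
    (hδ : 0 ≤ δ) (hg : ∀ j, |g j - g' j| ≤ δ) :
    ∑ k, zeroSign (x k i) * |g' ⬝ᵥ x k| - n * δ * (11 / 10 * τ)
      ≤ ∑ k, zeroSign (x k i) * |g ⬝ᵥ x k| := by
  have h1 : ∀ k, zeroSign (x k i) * |g' ⬝ᵥ x k| - zeroSign (x k i) * |g ⬝ᵥ x k|
      ≤ ∑ j, δ * |x k j| := fun k => by
    rw [← mul_sub]
    refine (le_abs_self _).trans ?_
    rw [abs_mul, abs_zeroSign, one_mul]
    refine (abs_abs_sub_abs_le _ _).trans ?_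
    rw [← sub_dotProduct, dotProduct]
    refine (Finset.abs_sum_le_sum_abs _ _).trans (Finset.sum_le_sum fun j _ => ?_)
    rw [abs_mul, Pi.sub_apply, abs_sub_comm]
    gcongr
    exact hg j
  have h2 := Finset.sum_le_sum fun k (_ : k ∈ Finset.univ) => h1 k
  rw [Finset.sum_comm, Finset.sum_sub_distrib] at h2
  have h3 : ∑ j, ∑ k, δ * |x k j| ≤ ∑ _j : Fin n, δ * (11 / 10 * τ) :=
    Finset.sum_le_sum fun j _ => by
      rw [← Finset.mul_sum]
      gcongr
      exact hl1 j
  simp at h3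
  linarith

/-- The sign condition passes from the integer grid to all vectors. -/
lemma GoodColumns.of_grid {p : ℕ} {τ : ℝ} (hτ : 0 ≤ τ) {x : Fin p → Fin n → ℝ}
    (hgram : ∀ i j, |∑ k, x k i * x k j - if i = j then τ else 0| ≤ τ / (1000 * n))
    (hl1 : ∀ i, ∑ k, |x k i| ≤ 11 / 10 * τ)
    (hgrid : ∀ i, ∀ m ∈ integerGrid n, m i = 0 → m ≠ 0 →
      29 / 200 * τ * √(∑ j, (m j : ℝ) ^ 2)
        ≤ ∑ k, zeroSign (x k i) * |(fun j => (m j : ℝ)) ⬝ᵥ x k|) :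
    GoodColumns τ x := by
  refine ⟨hgram, hl1, fun i g hgi => ?_⟩
  rcases (Finset.sum_nonneg fun j (_ : j ∈ Finset.univ) => sq_nonneg (g j)).eq_or_lt with h0 | h0
  · have hg : g = 0 := by
      funext j
      have := (Finset.sum_eq_zero_iff_of_nonneg fun j _ => sq_nonneg (g j)).1 h0.symm j
        (Finset.mem_univ j)
      simpa using this
    simp [hg]
  set s := √(∑ j, g j ^ 2)
  have hs : 0 < s := Real.sqrt_pos.2 h0
  have hs2 : s ^ 2 = ∑ j, g j ^ 2 := Real.sq_sqrt h0.le
  have hn : (1 : ℝ) ≤ n := by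
    exact_mod_cast Fin.pos i
  set N : ℝ := 1000 * n
  have hN : 0 < N := by positivity
  -- round `N g / s` to the integer grid
  set m : Fin n → ℤ := fun j => round (N / s * g j)
  have hm : ∀ j, |N / s * g j - m j| ≤ 1 / 2 := fun j => abs_sub_round _
  have hgs : ∀ j, |g j| ≤ s := fun j => by
    refine Real.abs_le_sqrt ?_
    exact Finset.single_le_sum (f := fun j => g j ^ 2) (fun _ _ => sq_nonneg _)
      (Finset.mem_univ j)
  have hbound : ∀ j, |N / s * g j| ≤ N := fun j => by
    rw [abs_mul, abs_of_pos (div_pos hN hs), div_mul_eq_mul_div, div_le_iff₀ hs]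
    exact mul_le_mul_of_nonneg_left (hgs j) hN.le
  have hmem : m ∈ integerGrid n := by
    rw [integerGrid, Fintype.mem_piFinset]
    intro j
    have h1 := abs_le.1 (hbound j)
    have h2 := abs_le.1 (hm j)
    rw [Finset.mem_Icc]
    have h3 : -(1000 * n : ℤ) - 1 < m j := by
      have : ((-(1000 * n : ℤ) - 1 : ℤ) : ℝ) < m j := by
        push_cast; linarith
      exact_mod_cast this
    have h4 : m j < (1000 * n : ℤ) + 1 := by
      have : (m j : ℝ) < (((1000 * n : ℤ) + 1 : ℤ) : ℝ) := by
        push_cast; linarith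
      exact_mod_cast this
    omega
  have hmi : m i = 0 := by simp [m, hgi]
  -- Rounding moves the vector of norm `N = 1000 n` by at most `n` in Euclidean norm.
  have hnorm : N * (1 - 1 / 1000) ≤ √(∑ j, (m j : ℝ) ^ 2) := by
    have e1 : ‖WithLp.toLp 2 (fun j => N / s * g j)‖ = N := by
      rw [EuclideanSpace.norm_eq]
      simp only [Real.norm_eq_abs, sq_abs, mul_pow]
      rw [← Finset.mul_sum, ← hs2, ← mul_pow, div_mul_cancel₀ _ hs.ne', Real.sqrt_sq hN.le]
    have e2 : ‖WithLp.toLp 2 (fun j => (m j : ℝ))‖ = √(∑ j, (m j : ℝ) ^ 2) := by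
      rw [EuclideanSpace.norm_eq]
      simp
    have e3 : ‖WithLp.toLp 2 (fun j => N / s * g j) - WithLp.toLp 2 (fun j => (m j : ℝ))‖ ≤ n := by
      rw [EuclideanSpace.norm_eq]
      refine Real.sqrt_le_iff.2 ⟨by positivity, ?_⟩
      have : ∀ j ∈ Finset.univ, ‖(WithLp.toLp 2 (fun j => N / s * g j)
          - WithLp.toLp 2 (fun j => (m j : ℝ)) : EuclideanSpace ℝ (Fin n)) j‖ ^ 2 ≤ (1 : ℝ) :=
        fun j _ => by
          have := hm j
          simp only [PiLp.sub_apply, Real.norm_eq_abs]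
          nlinarith [abs_nonneg (N / s * g j - m j)]
      refine (Finset.sum_le_sum this).trans ?_
      simp
      nlinarith
    have := norm_sub_norm_le (WithLp.toLp 2 (fun j => N / s * g j))
      (WithLp.toLp 2 (fun j => (m j : ℝ)))
    rw [e1, e2] at this
    have hN' : N = 1000 * n := rfl
    linarith
  have hm0 : m ≠ 0 := by
    intro h
    rw [h] at hnorm
    simp at hnorm
    linarith
  have h1 := hgrid i m hmem hmi hm0
  have h2 := sum_zeroSign_sub_le hl1 i (fun j => N / s * g j) (fun j => (m j : ℝ))
    (by norm_num) hm
  have h3 : ∑ k, zeroSign (x k i) * |(fun j => N / s * g j) ⬝ᵥ x k|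
      = N / s * ∑ k, zeroSign (x k i) * |g ⬝ᵥ x k| := by
    rw [Finset.mul_sum]
    refine Finset.sum_congr rfl fun k _ => ?_
    have : (fun j => N / s * g j) ⬝ᵥ x k = N / s * (g ⬝ᵥ x k) := smul_dotProduct (N / s) g (x k)
    rw [this, abs_mul, abs_of_pos (div_pos hN hs)]
    ring
  -- In units of `τ n`, the grid bound gives `0.145 · 999` and rounding loses `0.55`, which leaves
  -- more than the required `140`.
  have h4 : 7 / 50 * τ * N ≤ N / s * ∑ k, zeroSign (x k i) * |g ⬝ᵥ x k| := by
    rw [← h3]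
    refine le_trans ?_ h2
    have h5 := mul_le_mul_of_nonneg_left hnorm (by positivity : 0 ≤ 29 / 200 * τ)
    have hN' : N = 1000 * n := rfl
    have : 0 ≤ τ * n := by positivity
    rw [hN'] at h5 ⊢
    nlinarith
  have h5 : 7 / 50 * τ * s * N ≤ (∑ k, zeroSign (x k i) * |g ⬝ᵥ x k|) * N := by
    rw [div_mul_eq_mul_div N s, le_div_iff₀ hs] at h4
    linarith
  exact le_of_mul_le_mul_right h5 hN

/-- The smallest deviation used is the Gram one, `1 / (1000 n)`; its rate serves as a common bound
for every event in the union. -/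
lemma measure_sum_gt_le {p : ℕ} {F : (Fin n → ℝ) → ℝ} (h : SubexpMoment θ F) (hn : 1 ≤ n)
    {ε m b : ℝ} (hε : 1 / (1000 * n) ≤ ε) (hε1 : ε ≤ 1) (hm : ∫ x, F x ∂(columnLaw n θ) ≤ m)
    (hb : p * m + ε * (θ * p) ≤ b) :
    (columnsLaw n p θ).real {x | b < ∑ k, F (x k)}
      ≤ Real.exp (-(θ * p / (2048000000 * n ^ 2))) := by
  have hn' : (1 : ℝ) ≤ n := by exact_mod_cast hn
  have h0 : (0 : ℝ) ≤ 1 / (1000 * n) := by positivity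
  have hs : {x : Fin p → Fin n → ℝ | b < ∑ k, F (x k)}
      ⊆ {x | p * m + ε * (θ * p) ≤ ∑ k, F (x k)} := fun x hx => hb.trans (le_of_lt hx)
  refine (measureReal_mono hs).trans ((h.measure_sum_ge_le (h0.trans hε) hε1 hm).trans ?_)
  apply Real.exp_le_exp.2
  have hp : 0 ≤ (θ : ℝ) * p := mul_nonneg θ.2.1 (Nat.cast_nonneg p)
  have h1 : (1 / (1000 * n) : ℝ) ^ 2 ≤ ε ^ 2 := pow_le_pow_left₀ h0 hε 2
  have h2 : (θ : ℝ) * p / (2048000000 * n ^ 2) = (1 / (1000 * n) : ℝ) ^ 2 * (θ * p) / 2048 := by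
    field_simp
    ring
  rw [h2]
  gcongr

lemma measureReal_biUnion_le_card_mul {α ι : Type*} [MeasurableSpace α] (Q : Measure α)
    [IsFiniteMeasure Q] (s : Finset ι) (B : ι → Set α) {b : ℝ} (hB : ∀ i ∈ s, Q.real (B i) ≤ b) :
    Q.real (⋃ i ∈ s, B i) ≤ s.card * b := by
  refine (measureReal_biUnion_finset_le s B).trans ((Finset.sum_le_sum hB).trans ?_)
  simp

lemma measure_not_goodColumns_le {p : ℕ} (hn : 1 ≤ n) (hθ : (θ : ℝ) < 1 / 3) :
    (columnsLaw n p θ).real {x | ¬ GoodColumns (θ * p) x}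
      ≤ Real.exp (2005 * n ^ 2 - θ * p / (2048000000 * n ^ 2)) := by
  set Q := columnsLaw n p θ
  set b := Real.exp (-(θ * p / (2048000000 * n ^ 2)))
  set τ : ℝ := θ * p
  have hτ : 0 ≤ τ := mul_nonneg θ.2.1 (Nat.cast_nonneg p)
  have hn' : (1 : ℝ) ≤ n := by exact_mod_cast hn
  have hi1 : 1 / (1000 * n : ℝ) ≤ 1 / 1000 := by
    gcongr
    linarith
  set B1 : Fin n × Fin n → Set (Fin p → Fin n → ℝ) := fun q =>
    {x | (if q.1 = q.2 then τ else 0) + τ / (1000 * n) < ∑ k, x k q.1 * x k q.2}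
  set B2 : Fin n × Fin n → Set (Fin p → Fin n → ℝ) := fun q =>
    {x | -(if q.1 = q.2 then τ else 0) + τ / (1000 * n) < ∑ k, -(x k q.1 * x k q.2)}
  set B3 : Fin n → Set (Fin p → Fin n → ℝ) := fun i => {x | 11 / 10 * τ < ∑ k, |x k i|}
  set B4 : Fin n × (Fin n → ℤ) → Set (Fin p → Fin n → ℝ) := fun q =>
    {x | q.2 q.1 = 0 ∧ q.2 ≠ 0 ∧
      ∑ k, zeroSign (x k q.1) * |(fun j => (q.2 j : ℝ)) ⬝ᵥ x k|
        < 29 / 200 * τ * √(∑ j, (q.2 j : ℝ) ^ 2)}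
  have hsub : {x | ¬ GoodColumns τ x} ⊆ (⋃ q ∈ Finset.univ, B1 q) ∪ (⋃ q ∈ Finset.univ, B2 q)
      ∪ (⋃ i ∈ Finset.univ, B3 i) ∪ (⋃ q ∈ Finset.univ ×ˢ integerGrid n, B4 q) := by
    intro x hx
    by_contra hcon
    simp only [Set.mem_union, Set.mem_iUnion, not_or, not_exists] at hcon
    obtain ⟨⟨⟨h1, h2⟩, h3⟩, h4⟩ := hcon
    refine hx (GoodColumns.of_grid hτ (fun i j => ?_) (fun i => ?_) fun i m hm hmi hm0 => ?_)
    · have a1 := h1 (i, j) (Finset.mem_univ _)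
      have a2 := h2 (i, j) (Finset.mem_univ _)
      simp only [B1, B2, Set.mem_ofPred_eq, not_lt, Finset.sum_neg_distrib] at a1 a2
      rw [abs_le]
      constructor <;> linarith
    · have a3 := h3 i (Finset.mem_univ _)
      simpa only [B3, Set.mem_ofPred_eq, not_lt] using a3
    · have a4 := h4 (i, m) (by simp [hm])
      simp only [B4, Set.mem_ofPred_eq, not_and, not_lt] at a4
      exact a4 hmi hm0
  have m1 : ∀ q ∈ Finset.univ, Q.real (B1 q) ≤ b := fun q _ => by
    refine measure_sum_gt_le (SubexpMoment.mul_coord q.1 q.2) hn le_rfl (by linarith)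
      (integral_mul_coord q.1 q.2).le ?_
    apply le_of_eq
    split_ifs <;> simp only [τ] <;> ring
  have m2 : ∀ q ∈ Finset.univ, Q.real (B2 q) ≤ b := fun q _ => by
    refine measure_sum_gt_le (SubexpMoment.mul_coord q.1 q.2).neg hn le_rfl (by linarith)
      (by rw [integral_neg, integral_mul_coord q.1 q.2]) ?_
    apply le_of_eq
    split_ifs <;> simp only [τ] <;> ring
  have m3 : ∀ i ∈ Finset.univ, Q.real (B3 i) ≤ b := fun i _ => by
    have hF : SubexpMoment θ fun x : Fin n → ℝ => |x i| := by
      have := SubexpMoment.abs_dotProduct (θ := θ) (h := Pi.single i 1)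
        (by simp [Pi.single_apply])
      simpa using this
    refine measure_sum_gt_le hF hn (ε := 1 / 10) (by linarith) (by norm_num)
      (integral_abs_coord_le i) ?_
    apply le_of_eq
    simp only [τ]
    ring
  have m4 : ∀ q ∈ Finset.univ ×ˢ integerGrid n, Q.real (B4 q) ≤ b := by
    rintro ⟨i, m⟩ -
    by_cases hm : m i = 0 ∧ m ≠ 0
    · obtain ⟨hmi, hm0⟩ := hm
      set s := √(∑ j, (m j : ℝ) ^ 2)
      have h0 : 0 < ∑ j, (m j : ℝ) ^ 2 := by
        obtain ⟨j, hj⟩ := Function.ne_iff.1 hm0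
        refine Finset.sum_pos' (fun _ _ => sq_nonneg _) ⟨j, Finset.mem_univ j, ?_⟩
        have : (m j : ℝ) ≠ 0 := by exact_mod_cast hj
        positivity
      have hs : 0 < s := Real.sqrt_pos.2 h0
      have hs2 : s ^ 2 = ∑ j, (m j : ℝ) ^ 2 := Real.sq_sqrt h0.le
      set h : Fin n → ℝ := fun j => s⁻¹ * m j
      have hh : ∑ j, h j ^ 2 = 1 := by
        simp only [h, mul_pow]
        rw [← Finset.mul_sum, ← hs2, ← mul_pow, inv_mul_cancel₀ hs.ne', one_pow]
      have hi : h i = 0 := by simp [h, hmi]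
      have hsub : B4 (i, m) ⊆ {x | -(29 / 200 * τ) < ∑ k, -(zeroSign (x k i) * |h ⬝ᵥ x k|)} := by
        rintro x ⟨-, -, hx⟩
        simp only [Set.mem_ofPred_eq, Finset.sum_neg_distrib, neg_lt_neg_iff]
        have e : ∀ k, |h ⬝ᵥ x k| = s⁻¹ * |(fun j => (m j : ℝ)) ⬝ᵥ x k| := fun k => by
          have : h ⬝ᵥ x k = s⁻¹ * ((fun j => (m j : ℝ)) ⬝ᵥ x k) := smul_dotProduct s⁻¹ _ (x k)
          rw [this, abs_mul, abs_of_pos (inv_pos.2 hs)]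
        simp_rw [e, mul_left_comm _ s⁻¹]
        rw [← Finset.mul_sum, inv_mul_lt_iff₀ hs]
        exact hx.trans_eq (mul_comm _ _)
      refine (measureReal_mono hsub).trans ?_
      -- The mean is at least `3/20 θ`, and `3/20 - 1/200 = 29/200`.
      refine measure_sum_gt_le (SubexpMoment.zeroSign_mul i hh).neg hn (ε := 1 / 200)
        (m := -(3 / 20 * θ)) (by linarith) (by norm_num) ?_ ?_
      · rw [integral_neg]
        exact neg_le_neg (le_integral_zeroSign_mul hθ hi hh)
      · apply le_of_eq
        simp only [τ]
        ring
    · have : B4 (i, m) = ∅ := by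
        ext x
        simp only [B4, Set.mem_ofPred_eq, Set.mem_empty_iff_false, iff_false]
        tauto
      rw [this]
      simpa using (Real.exp_pos _).le
  have u1 := measureReal_biUnion_le_card_mul Q _ B1 m1
  have u2 := measureReal_biUnion_le_card_mul Q _ B2 m2
  have u3 := measureReal_biUnion_le_card_mul Q _ B3 m3
  have u4 := measureReal_biUnion_le_card_mul Q _ B4 m4
  rw [Finset.card_product, card_integerGrid] at u4
  simp only [Finset.card_univ, Fintype.card_prod, Fintype.card_fin] at u1 u2 u3 u4
  push_cast at u1 u2 u3 u4
  have htot : Q.real {x | ¬ GoodColumns τ x}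
      ≤ n * n * b + n * n * b + n * b + n * (2000 * n + 1) ^ n * b := by
    refine (measureReal_mono hsub).trans ?_
    refine (measureReal_union_le _ _).trans (add_le_add ?_ u4)
    refine (measureReal_union_le _ _).trans (add_le_add ?_ u3)
    exact (measureReal_union_le _ _).trans (add_le_add u1 u2)
  refine htot.trans ?_
  have hb : 0 < b := Real.exp_pos _
  set A : ℝ := (2000 * n + 1) ^ n
  have hA1 : 1 ≤ A := one_le_pow₀ (by linarith)
  have hA : A ≤ Real.exp (2001 * n ^ 2) := by
    have : (2000 * n + 1 : ℝ) ≤ Real.exp (2001 * n) := by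
      have := Real.add_one_le_exp (2001 * n : ℝ)
      linarith
    refine (pow_le_pow_left₀ (by positivity) this n).trans_eq ?_
    rw [← Real.exp_nat_mul]
    ring_nf
  have h4 : (4 * n ^ 2 : ℝ) ≤ Real.exp (4 * n ^ 2) := by
    linarith [Real.add_one_le_exp (4 * n ^ 2 : ℝ)]
  calc n * n * b + n * n * b + n * b + n * A * b
      = (2 * n ^ 2 + n + n * A) * b := by ring
    _ ≤ (4 * n ^ 2 * A) * b := by
        gcongr
        have e1 : (n : ℝ) ≤ n ^ 2 := le_self_pow₀ hn' two_ne_zero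
        have e2 : (n : ℝ) * A ≤ n ^ 2 * A := by gcongr
        have e3 : (n : ℝ) ^ 2 ≤ n ^ 2 * A := le_mul_of_one_le_right (by positivity) hA1
        linarith
    _ ≤ (Real.exp (4 * n ^ 2) * Real.exp (2001 * n ^ 2)) * b := by gcongr
    _ = _ := by
        rw [← Real.exp_add, ← Real.exp_add]
        congr 1
        ring

end

/-! ### Deterministic recovery for whitened data -/

section

variable {n p : ℕ} {τ : ℝ} {X : Matrix (Fin n) (Fin p) ℝ}

lemma invSqrt_mul_mul_invSqrt {S : Matrix (Fin n) (Fin n) ℝ} (hS : S.PosDef) :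
    invSqrt S * S * invSqrt S = 1 := by
  have hsa : IsSelfAdjoint S := hS.isHermitian
  have hpos : ∀ x ∈ spectrum ℝ S, 0 < x := fun x hx => by
    rw [hS.isHermitian.spectrum_real_eq_range_eigenvalues] at hx
    obtain ⟨i, rfl⟩ := hx
    exact hS.eigenvalues_pos i
  have hc : ContinuousOn (fun x : ℝ => (Real.sqrt x)⁻¹) (spectrum ℝ S) :=
    (Real.continuous_sqrt.continuousOn).inv₀ fun x hx => (Real.sqrt_pos.2 (hpos x hx)).ne'
  have h1 : invSqrt S * S = cfc (fun x : ℝ => (Real.sqrt x)⁻¹ * x) S := by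
    rw [cfc_mul (fun x : ℝ => (Real.sqrt x)⁻¹) (fun x => x) S hc continuousOn_id, cfc_id' ℝ S]
    rfl
  rw [h1, invSqrt, ← cfc_mul (fun x : ℝ => (Real.sqrt x)⁻¹ * x) _ S (hc.mul continuousOn_id) hc]
  rw [← cfc_const_one ℝ S]
  refine cfc_congr fun x hx => ?_
  have h0 := hpos x hx
  have := Real.sqrt_pos.2 h0
  have h2 := Real.mul_self_sqrt h0.le
  field_simp
  nlinarith

lemma transpose_invSqrt (S : Matrix (Fin n) (Fin n) ℝ) : (invSqrt S)ᵀ = invSqrt S := by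
  have : IsSelfAdjoint (invSqrt S) := cfc_predicate _ _
  have h := this.star_eq
  rwa [star_eq_conjTranspose, conjTranspose_eq_transpose_of_trivial] at h

/-- Cauchy–Schwarz, `(∑ |zᵢ|)² ≤ n ∑ zᵢ²`, cancels the `n` in the entrywise tolerance `τ / (1000
n)`. -/
lemma GoodColumns.abs_quadratic_sub_le (h : GoodColumns τ fun k i => X i k) (hτ : 0 ≤ τ)
    (z : Fin n → ℝ) :
    |z ⬝ᵥ (X * Xᵀ) *ᵥ z - τ * ∑ i, z i ^ 2| ≤ τ / 1000 * ∑ i, z i ^ 2 := by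
  have e : z ⬝ᵥ (X * Xᵀ) *ᵥ z - τ * ∑ i, z i ^ 2
      = ∑ i, ∑ j, z i * z j * (∑ k, X i k * X j k - if i = j then τ else 0) := by
    simp only [mul_sub, Finset.sum_sub_distrib, mul_ite, mul_zero, Finset.sum_ite_eq,
      Finset.mem_univ, if_true]
    congr 1
    · simp only [dotProduct, mulVec, mul_apply, transpose_apply, Finset.mul_sum]
      refine Finset.sum_congr rfl fun i _ => Finset.sum_congr rfl fun j _ => ?_
      rw [Finset.sum_mul, Finset.mul_sum]
      exact Finset.sum_congr rfl fun k _ => by ring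
    · rw [Finset.mul_sum]
      exact Finset.sum_congr rfl fun i _ => by ring
  rw [e]
  calc |∑ i, ∑ j, z i * z j * (∑ k, X i k * X j k - if i = j then τ else 0)|
      ≤ ∑ i, ∑ j, |z i| * |z j| * (τ / (1000 * n)) := by
        refine (Finset.abs_sum_le_sum_abs _ _).trans (Finset.sum_le_sum fun i _ => ?_)
        refine (Finset.abs_sum_le_sum_abs _ _).trans (Finset.sum_le_sum fun j _ => ?_)
        rw [abs_mul, abs_mul]
        exact mul_le_mul_of_nonneg_left (h.gram i j) (by positivity)
    _ = (∑ i, |z i|) ^ 2 * (τ / (1000 * n)) := by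
        rw [sq, Finset.sum_mul_sum, Finset.sum_mul]
        exact Finset.sum_congr rfl fun i _ => (Finset.sum_mul _ _ _).symm
    _ ≤ (n * ∑ i, z i ^ 2) * (τ / (1000 * n)) := by
        have := sq_sum_le_card_mul_sum_sq (s := Finset.univ) (f := fun i => |z i|)
        simp only [sq_abs, Finset.card_univ, Fintype.card_fin] at this
        gcongr
    _ ≤ _ := by
        rcases Nat.eq_zero_or_pos n with hn | hn
        · subst hn; simp
        · have : (n : ℝ) ≠ 0 := by positivity
          apply le_of_eq
          field_simp

lemma GoodColumns.posDef (h : GoodColumns τ fun k i => X i k) (hτ : 0 < τ) :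
    (X * Xᵀ).PosDef := by
  refine .of_dotProduct_mulVec_pos ?_ fun z hz => ?_
  · have := isHermitian_mul_conjTranspose_self X
    rwa [conjTranspose_eq_transpose_of_trivial] at this
  · obtain ⟨j, hj⟩ := Function.ne_iff.1 hz
    have h0 : 0 < ∑ i, z i ^ 2 := by
      refine Finset.sum_pos' (fun _ _ => sq_nonneg _) ⟨j, Finset.mem_univ j, ?_⟩
      have : z j ≠ 0 := hj
      positivity
    have := abs_le.1 (h.abs_quadratic_sub_le hτ.le z)
    have h1 := mul_pos hτ h0
    rw [star_trivial]
    linarith [this.1]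

/-- Equality where `b = 0`, the reverse triangle inequality elsewhere. -/
lemma zeroSign_mul_le (a b v : ℝ) : |a| * |b| + zeroSign b * |v| ≤ |a * b + v| := by
  unfold zeroSign
  split_ifs with hb
  · simp [hb]
  · have := abs_sub_abs_le_abs_sub (a * b) (-v)
    rw [abs_neg, abs_mul, sub_neg_eq_add] at this
    linarith

/-- The rounding program in the coordinates of the dictionary: the objective at a feasible `z`
exceeds its value at `eᵢ / uᵢ` by a multiple of the distance of `z` from the `i`-th axis. -/
lemma GoodColumns.le_sum_abs (h : GoodColumns τ fun k i => X i k)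
    {u z : Fin n → ℝ} {i : Fin n} (hui : u i ≠ 0)
    (hu : ∑ j, u j ^ 2 ≤ (1 + (11 / 100) ^ 2) * u i ^ 2) (huz : u ⬝ᵥ z = 1) :
    |(u i)⁻¹| * ∑ k, |X i k| + 19 / 1000 * τ * √(∑ j, (Function.update z i 0 j) ^ 2)
      ≤ ∑ k, |(z ᵥ* X) k| := by
  set g := Function.update z i 0
  set s := √(∑ j, g j ^ 2)
  have hgi : g i = 0 := by simp [g]
  have hz : z = Pi.single i (z i) + g := by
    funext j
    by_cases hj : j = i
    · subst hj; simp [hgi]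
    · simp [g, hj]
  have hs0 : 0 ≤ s := Real.sqrt_nonneg _
  have hs2 : s ^ 2 = ∑ j, g j ^ 2 := Real.sq_sqrt (Finset.sum_nonneg fun j _ => sq_nonneg (g j))
  set w := Function.update u i 0
  have hw2 : ∑ j, w j ^ 2 ≤ (11 / 100 * |u i|) ^ 2 := by
    have : ∑ j, u j ^ 2 = u i ^ 2 + ∑ j, w j ^ 2 := by
      rw [← Finset.add_sum_erase _ _ (Finset.mem_univ i),
        ← Finset.add_sum_erase Finset.univ (fun j => w j ^ 2) (Finset.mem_univ i)]
      simp only [w, Function.update_self]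
      rw [show (0 : ℝ) ^ 2 = 0 by norm_num, zero_add]
      congr 1
      refine Finset.sum_congr rfl fun j hj => ?_
      rw [Function.update_of_ne (Finset.ne_of_mem_erase hj)]
    rw [mul_pow, sq_abs]
    linarith
  have hug : |u ⬝ᵥ g| ≤ 11 / 100 * |u i| * s := by
    have e : u ⬝ᵥ g = ∑ j, w j * g j := by
      refine Finset.sum_congr rfl fun j _ => ?_
      by_cases hj : j = i
      · subst hj; simp [hgi]
      · simp [w, hj]
    rw [e]
    refine abs_le_of_sq_le_sq ?_ (by positivity)
    refine (Finset.sum_mul_sq_le_sq_mul_sq _ _ _).trans ?_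
    rw [mul_pow _ s, hs2]
    exact mul_le_mul_of_nonneg_right hw2 (Finset.sum_nonneg fun j _ => sq_nonneg _)
  have huz' : u i * z i + u ⬝ᵥ g = 1 := by
    rw [hz, dotProduct_add, dotProduct_single] at huz
    exact huz
  have hzi : |(u i)⁻¹| - 11 / 100 * s ≤ |z i| := by
    have hu0 : 0 < |u i| := abs_pos.2 hui
    have h1 : 1 ≤ |u i| * |z i| + |u ⬝ᵥ g| := by
      rw [← abs_mul]
      calc (1 : ℝ) = |u i * z i + u ⬝ᵥ g| := by rw [huz', abs_one]
        _ ≤ _ := abs_add_le _ _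
    have h2 : |u i| * (|(u i)⁻¹| - 11 / 100 * s) ≤ |u i| * |z i| := by
      rw [mul_sub, abs_inv, mul_inv_cancel₀ hu0.ne']
      linarith
    exact le_of_mul_le_mul_left h2 hu0
  have hcol : ∀ k, (z ᵥ* X) k = z i * X i k + g ⬝ᵥ fun j => X j k := fun k => by
    conv_lhs => rw [hz]
    rw [add_vecMul, Pi.add_apply, single_vecMul]
    rfl
  have hsum : |z i| * ∑ k, |X i k| + 7 / 50 * τ * s ≤ ∑ k, |(z ᵥ* X) k| := by
    refine (add_le_add_right (h.sign i g hgi) _).trans ?_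
    rw [Finset.mul_sum, ← Finset.sum_add_distrib]
    refine Finset.sum_le_sum fun k _ => ?_
    rw [hcol]
    exact zeroSign_mul_le _ _ _
  have hl := h.row_l1 i
  have hl0 : 0 ≤ ∑ k, |X i k| := Finset.sum_nonneg fun k _ => abs_nonneg _
  have h1 := mul_le_mul_of_nonneg_right hzi hl0
  have h2 := mul_le_mul_of_nonneg_left hl hs0
  -- The surviving gain is `7/50 - (11/100)(11/10) = 19/1000`.
  nlinarith

lemma inner_eq_dotProduct (r q : EuclideanSpace ℝ (Fin n)) :
    inner ℝ r q = r.ofLp ⬝ᵥ q.ofLp := by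
  rw [EuclideanSpace.inner_eq_star_dotProduct, star_trivial, dotProduct_comm]

lemma norm_sq_eq_dotProduct (q : EuclideanSpace ℝ (Fin n)) :
    ‖q‖ ^ 2 = q.ofLp ⬝ᵥ q.ofLp := by
  rw [← real_inner_self_eq_norm_sq, inner_eq_dotProduct]

/-- Recovery by the rounding program for data `M X` with `M` a whitening matrix of `X`. -/
theorem GoodColumns.lp_recovery (h : GoodColumns τ fun k i => X i k) (hτ : 0 < τ)
    {M : Matrix (Fin n) (Fin n) ℝ} (hM : M * (X * Xᵀ) * Mᵀ = τ • (1 : Matrix (Fin n) (Fin n) ℝ))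
    (i : Fin n) :
    (∃ q, IsTarget (M * X) X i q) ∧
      ∀ q, IsTarget (M * X) X i q → ∀ r : EuclideanSpace ℝ (Fin n), ‖r‖ = 1 →
        249 / 250 ≤ inner ℝ r q → lpSolutions (M * X) r = {(inner ℝ r q)⁻¹ • q} := by
  set N := τ⁻¹ • ((X * Xᵀ) * Mᵀ)
  have hMN : M * N = 1 := by
    simp only [N]
    rw [Matrix.mul_smul, ← Matrix.mul_assoc, hM, smul_smul, inv_mul_cancel₀ hτ.ne', one_smul]
  have hNM : N * M = 1 := mul_eq_one_comm.1 hMN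
  have hback : ∀ z : Fin n → ℝ, (z ᵥ* N) ᵥ* M = z := fun z => by
    rw [vecMul_vecMul, hNM, vecMul_one]
  have hforth : ∀ q : Fin n → ℝ, (q ᵥ* M) ᵥ* N = q := fun q => by
    rw [vecMul_vecMul, hMN, vecMul_one]
  have hquad : ∀ q : Fin n → ℝ, (q ᵥ* M) ⬝ᵥ (X * Xᵀ) *ᵥ (q ᵥ* M) = τ * (q ⬝ᵥ q) := fun q => by
    rw [← dotProduct_mulVec, ← mulVec_transpose M q, mulVec_mulVec, mulVec_mulVec,
      hM, smul_mulVec, one_mulVec, dotProduct_smul, smul_eq_mul]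
  have hGunit : IsUnit (X * Xᵀ) := (h.posDef hτ).isUnit
  have hXinj : ∀ z z' : Fin n → ℝ, z ᵥ* X = z' ᵥ* X → z = z' := fun z z' hz => by
    have : z ᵥ* (X * Xᵀ) = z' ᵥ* (X * Xᵀ) := by
      rw [← vecMul_vecMul, hz, vecMul_vecMul]
    exact vecMul_injective_iff_isUnit.2 hGunit this
  have hrow : ∀ α : ℝ, (Pi.single i α : Fin n → ℝ) ᵥ* X = α • X i := fun α => by
    rw [single_vecMul]; rfl
  refine ⟨⟨WithLp.toLp 2 ((Pi.single i 1 : Fin n → ℝ) ᵥ* N), 1, one_ne_zero, ?_, .inr abs_one⟩, ?_⟩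
  · rw [← vecMul_vecMul, hback, hrow]
  rintro q ⟨α, hα, hq, hnorm⟩ r hr hrq
  have hqM : q.ofLp ᵥ* M = Pi.single i α := by
    apply hXinj
    rw [vecMul_vecMul, hq, hrow]
  set u : Fin n → ℝ := N *ᵥ r.ofLp
  have hinner : ∀ q : EuclideanSpace ℝ (Fin n), inner ℝ r q = u ⬝ᵥ (q.ofLp ᵥ* M) := fun q => by
    rw [inner_eq_dotProduct, dotProduct_comm, dotProduct_comm u, ← dotProduct_mulVec,
      mulVec_mulVec, hMN, one_mulVec]
  have hnormq : ∀ q : EuclideanSpace ℝ (Fin n),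
      |‖q‖ ^ 2 - ∑ j, (q.ofLp ᵥ* M) j ^ 2| ≤ 1 / 1000 * ∑ j, (q.ofLp ᵥ* M) j ^ 2 := fun q => by
    have := h.abs_quadratic_sub_le hτ.le (q.ofLp ᵥ* M)
    rw [hquad, ← mul_sub, abs_mul, abs_of_pos hτ, ← norm_sq_eq_dotProduct] at this
    refine le_of_mul_le_mul_left (this.trans_eq ?_) hτ
    ring
  -- Test `r` against the `q'` whose coordinates are `u` itself: then `⟨r, q'⟩ = ‖u‖²`, while `‖q'‖²
  -- ≤ (1 + 1/1000) ‖u‖²`.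
  have hu1 : ∑ j, u j ^ 2 ≤ 1 + 1 / 1000 := by
    set q' : EuclideanSpace ℝ (Fin n) := WithLp.toLp 2 (u ᵥ* N)
    have hq' : q'.ofLp ᵥ* M = u := hback u
    have h1 := abs_le.1 (hnormq q')
    have h2 := hinner q'
    have h3 := real_inner_le_norm r q'
    rw [hq'] at h1 h2
    have h4 : u ⬝ᵥ u = ∑ j, u j ^ 2 := Finset.sum_congr rfl fun j _ => (sq _).symm
    rw [hr, one_mul, h2, h4] at h3
    set S := ∑ j, u j ^ 2
    have hS : 0 ≤ S := Finset.sum_nonneg fun j _ => sq_nonneg _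
    rcases hS.eq_or_lt with h0 | h0
    · rw [← h0]; norm_num
    · have h5 : S ^ 2 ≤ ‖q'‖ ^ 2 := by gcongr
      have h6 : S * S ≤ S * (1 + 1 / 1000) := by linarith [h1.2]
      exact le_of_mul_le_mul_left h6 h0
  have hrq' : inner ℝ r q = α * u i := by
    rw [hinner, hqM, dotProduct_single, mul_comm]
  -- This is the only place where the normalization of the target matters.
  have hα2 : α ^ 2 * (999 / 1000) ≤ 1 := by
    rcases hnorm with h1 | h1
    · have h2 := abs_le.1 (hnormq q)
      rw [hqM, h1] at h2
      have h3 : ∑ j, (Pi.single i α : Fin n → ℝ) j ^ 2 = α ^ 2 := by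
        simp [Pi.single_apply]
      rw [h3] at h2
      linarith [h2.1]
    · rw [← sq_abs, h1]; norm_num
  rw [hrq'] at hrq
  have hui2 : (249 / 250) ^ 2 * (999 / 1000) ≤ u i ^ 2 := by
    have h1 : (249 / 250 : ℝ) ^ 2 ≤ (α * u i) ^ 2 := by gcongr
    rw [mul_pow] at h1
    nlinarith [sq_nonneg (u i)]
  have hui : u i ≠ 0 := by
    intro h0
    rw [h0] at hui2
    norm_num at hui2
  -- Here `249/250` is used up: `1.0121 · (249/250)² · 0.999 ≈ 1.003` exceeds `1.001`.
  have hu2 : ∑ j, u j ^ 2 ≤ (1 + (11 / 100) ^ 2) * u i ^ 2 := by linarith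
  set q₀ := (inner ℝ r q)⁻¹ • q
  have hq₀M : q₀.ofLp ᵥ* M = Pi.single i (u i)⁻¹ := by
    simp only [q₀, hrq', WithLp.ofLp_smul]
    rw [smul_vecMul, hqM, ← Pi.single_smul, smul_eq_mul, mul_inv]
    congr 1
    field_simp
  have hq₀r : inner ℝ r q₀ = 1 := by
    rw [hinner, hq₀M, dotProduct_single, mul_inv_cancel₀ hui]
  have hq₀v : lpObjective (M * X) q₀ = |(u i)⁻¹| * ∑ k, |X i k| := by
    unfold lpObjective
    rw [← vecMul_vecMul, hq₀M, hrow, Finset.mul_sum]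
    simp [abs_mul]
  have hlow : ∀ q', inner ℝ r q' = 1 → |(u i)⁻¹| * ∑ k, |X i k|
      + 19 / 1000 * τ * √(∑ j, (Function.update (q'.ofLp ᵥ* M) i 0 j) ^ 2)
        ≤ lpObjective (M * X) q' := fun q' hq' => by
    rw [hinner] at hq'
    have := h.le_sum_abs hui hu2 hq'
    rwa [vecMul_vecMul] at this
  ext q'
  rw [Set.mem_singleton_iff]
  constructor
  · rintro ⟨h1, h2⟩
    have h3 := (hlow q' h1).trans (h2 q₀ hq₀r)
    rw [hq₀v] at h3
    set z := q'.ofLp ᵥ* M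
    have h4 : √(∑ j, (Function.update z i 0 j) ^ 2) ≤ 0 := by
      have := hτ
      by_contra! h5
      have : 0 < 19 / 1000 * τ * √(∑ j, (Function.update z i 0 j) ^ 2) := by positivity
      linarith
    have h5 : ∀ j, Function.update z i 0 j = 0 := fun j => by
      have h6 := Real.sqrt_eq_zero'.1 (le_antisymm h4 (Real.sqrt_nonneg _))
      have h7 := (Finset.single_le_sum (f := fun j => (Function.update z i 0 j) ^ 2)
        (fun _ _ => sq_nonneg _) (Finset.mem_univ j)).trans h6
      exact pow_eq_zero_iff two_ne_zero |>.1 (le_antisymm h7 (sq_nonneg _))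
    have hz : z = Pi.single i (z i) := by
      funext j
      by_cases hj : j = i
      · subst hj; simp
      · have := h5 j
        simpa [hj] using this
    have hzi : z i = (u i)⁻¹ := by
      rw [hinner] at h1
      change u ⬝ᵥ z = 1 at h1
      rw [hz, dotProduct_single] at h1
      exact eq_inv_of_mul_eq_one_right h1
    have hzz : z = q₀.ofLp ᵥ* M := by rw [hq₀M, hz, hzi]
    have : q'.ofLp = q₀.ofLp := by
      rw [← hforth q'.ofLp, ← hforth q₀.ofLp]
      exact congrArg (· ᵥ* N) hzz
    exact WithLp.ofLp_injective 2 this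
  · rintro rfl
    refine ⟨hq₀r, fun q' hq' => ?_⟩
    rw [hq₀v]
    refine le_trans ?_ (hlow q' hq')
    have : 0 ≤ 19 / 1000 * τ * √(∑ j, (Function.update (q'.ofLp ᵥ* M) i 0 j) ^ 2) := by
      positivity
    linarith

end

/-! ### Preconditioning and the sample size -/

section

variable {n p : ℕ}

lemma GoodColumns.precond_recovery {θ : ℝ} {X : Matrix (Fin n) (Fin p) ℝ} (hτ : 0 < θ * p)
    (h : GoodColumns (θ * p) fun k i => X i k) {A : Matrix (Fin n) (Fin n) ℝ} (hA : IsUnit A) :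
    IsUnit ((A * X) * (A * X)ᵀ) ∧ ∀ i : Fin n,
      (∃ q, IsTarget (precond θ (A * X)) X i q) ∧
      ∀ q, IsTarget (precond θ (A * X)) X i q → ∀ r : EuclideanSpace ℝ (Fin n), ‖r‖ = 1 →
        249 / 250 ≤ inner ℝ r q →
          lpSolutions (precond θ (A * X)) r = {(inner ℝ r q)⁻¹ • q} := by
  set S := (A * X) * (A * X)ᵀ with hS
  have hSA : S = A * (X * Xᵀ) * Aᵀ := by
    rw [hS, transpose_mul]
    simp only [Matrix.mul_assoc]
  have hSpos : S.PosDef := by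
    rw [hSA]
    have := (h.posDef hτ).mul_mul_conjTranspose_same (B := A)
      (vecMul_injective_iff_isUnit.2 hA)
    rwa [conjTranspose_eq_transpose_of_trivial] at this
  refine ⟨hSpos.isUnit, fun i => ?_⟩
  set M := Real.sqrt (θ * p) • (invSqrt S * A)
  have hpre : precond θ (A * X) = M * X := by
    simp only [precond, M, ← hS]
    rw [Matrix.smul_mul, Matrix.mul_assoc]
  rw [hpre]
  refine h.lp_recovery hτ ?_ i
  have h1 : M * (X * Xᵀ) * Mᵀ
      = (Real.sqrt (θ * p) * Real.sqrt (θ * p)) • (invSqrt S * S * invSqrt S) := by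
    simp only [M, transpose_smul, transpose_mul, transpose_invSqrt, Matrix.smul_mul,
      Matrix.mul_smul, smul_smul, Matrix.mul_assoc, hSA]
  rw [h1, invSqrt_mul_mul_invSqrt hSpos, Real.mul_self_sqrt hτ.le]

lemma one_le_condNumber (hn : 1 ≤ n) {A : Matrix (Fin n) (Fin n) ℝ} (hA : IsUnit A) :
    1 ≤ condNumber A := by
  have : Nonempty (Fin n) := ⟨⟨0, hn⟩⟩
  have h1 : toEuclideanCLM (𝕜 := ℝ) A * toEuclideanCLM (𝕜 := ℝ) A⁻¹ = 1 := by
    rw [← map_mul, mul_nonsing_inv A ((isUnit_iff_isUnit_det A).1 hA), map_one]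
  have h2 := norm_mul_le (toEuclideanCLM (𝕜 := ℝ) A) (toEuclideanCLM (𝕜 := ℝ) A⁻¹)
  rwa [h1, norm_one] at h2

/-- The sample size makes the expected squared row norm `θ p` at least `n⁵ log (n / θ)`. -/
lemma le_mul_of_sample_size {C θ μ κ : ℝ} {P : ℝ} (hn : 1 ≤ n) (hC : 0 < C) (hθ : 0 < θ)
    (hθ3 : θ < 1 / 3) (hμ : 0 < μ) (hμ1 : μ ≤ 1) (hκ : 1 ≤ κ)
    (hP : C / θ * max ((n : ℝ) ^ 4 / μ ^ 4) ((n : ℝ) ^ 5 / μ ^ 2) * κ ^ 8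
      * Real.log (κ * n / (μ * θ)) ^ 4 ≤ P) :
    1 ≤ Real.log (n / θ) ∧ C * (n ^ 5 * Real.log (n / θ)) ≤ θ * P := by
  have hn' : (1 : ℝ) ≤ n := by exact_mod_cast hn
  have hL : 1 ≤ Real.log (n / θ) := by
    rw [Real.le_log_iff_exp_le (by positivity), le_div_iff₀ hθ]
    have := Real.exp_one_lt_d9
    nlinarith [Real.exp_pos 1]
  have hLL : Real.log (n / θ) ≤ Real.log (κ * n / (μ * θ)) := by
    apply Real.log_le_log (by positivity)
    gcongr
    · nlinarith
    · nlinarith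
  refine ⟨hL, ?_⟩
  set L := Real.log (n / θ)
  set L' := Real.log (κ * n / (μ * θ))
  have h1 : L ≤ L' ^ 4 := hLL.trans (le_self_pow₀ (hL.trans hLL) (by norm_num))
  have h2 : (n : ℝ) ^ 5 ≤ max ((n : ℝ) ^ 4 / μ ^ 4) ((n : ℝ) ^ 5 / μ ^ 2) := by
    refine le_max_of_le_right ((le_div_iff₀ (by positivity)).2 ?_)
    exact mul_le_of_le_one_right (by positivity) (pow_le_one₀ hμ.le hμ1)
  have h3 : (1 : ℝ) ≤ κ ^ 8 := one_le_pow₀ hκ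
  calc C * (n ^ 5 * L) = θ * (C / θ * n ^ 5 * 1 * L) := by field_simp
    _ ≤ θ * (C / θ * max ((n : ℝ) ^ 4 / μ ^ 4) ((n : ℝ) ^ 5 / μ ^ 2) * κ ^ 8 * L' ^ 4) := by
        gcongr
    _ ≤ θ * P := by gcongr

/-- The failure probability of the regularity of the columns is polynomially small. -/
lemma exp_sub_le_inv_pow {K θ : ℝ} (hn : 1 ≤ n) (hp : 1 ≤ p) (hK : 2005 ≤ K) (hθ : 0 < θ)
    (hL : 1 ≤ Real.log (n / θ))
    (h : (48 * K) ^ 4 * (n ^ 5 * Real.log (n / θ)) ≤ θ * p) :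
    Real.exp (2005 * n ^ 2 - θ * p / (K * n ^ 2)) ≤ 1 / (p : ℝ) ^ 6 := by
  have hn' : (1 : ℝ) ≤ n := by exact_mod_cast hn
  have hp' : (0 : ℝ) < p := by exact_mod_cast hp
  set τ := θ * p
  set L := Real.log (n / θ)
  have hτ : 0 < τ := by positivity
  have hlogp : Real.log p ≤ Real.log τ + L := by
    have e : (p : ℝ) = τ * θ⁻¹ := by simp only [τ]; field_simp
    rw [e, Real.log_mul hτ.ne' (by positivity)]
    have hθn : θ⁻¹ ≤ n / θ := by
      rw [← one_div]
      gcongr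
    linarith [Real.log_le_log (by positivity) hθn]
  -- With a fourth root, `log τ ≤ 4 w` and `n² ≤ w²`, so `6 log τ · 2 K n² ≤ 48 K w³ ≤ w⁴ = τ`;
  -- hence the constant `(48 K)⁴`.
  obtain ⟨w, hw, hw4⟩ : ∃ w : ℝ, 0 < w ∧ w ^ 4 = τ :=
    ⟨τ ^ (1 / 4 : ℝ), by positivity, by
      rw [← Real.rpow_natCast, ← Real.rpow_mul hτ.le]; norm_num⟩
  have hK0 : (0 : ℝ) < K := by linarith
  have hK1 : K ≤ (48 * K) ^ 4 := by
    have : 48 * K ≤ (48 * K) ^ 4 := le_self_pow₀ (by linarith) (by norm_num)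
    linarith
  have hnL : (n : ℝ) ^ 4 ≤ n ^ 5 * L := by
    have h5 : (n : ℝ) ^ 4 ≤ n ^ 5 := pow_le_pow_right₀ hn' (by norm_num)
    exact h5.trans (le_mul_of_one_le_right (by positivity) hL)
  have hnL1 : 1 ≤ (n : ℝ) ^ 5 * L := (one_le_pow₀ hn').trans hnL
  have hw48 : 48 * K ≤ w := by
    refine le_of_pow_le_pow_left₀ (n := 4) (by norm_num) hw.le ?_
    rw [hw4]
    exact (le_mul_of_one_le_right (by positivity) hnL1).trans h
  have hnw : (n : ℝ) ^ 2 ≤ w ^ 2 := by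
    refine le_of_pow_le_pow_left₀ (n := 2) (by norm_num) (by positivity) ?_
    have h1 : (n ^ 5 * L : ℝ) ≤ (48 * K) ^ 4 * (n ^ 5 * L) :=
      le_mul_of_one_le_left (by positivity) (by linarith)
    calc ((n : ℝ) ^ 2) ^ 2 = n ^ 4 := by ring
      _ ≤ τ := hnL.trans (h1.trans h)
      _ = _ := by rw [← hw4]; ring
  have hlogτ : Real.log τ ≤ 4 * w := by
    rw [← hw4, Real.log_pow]
    have := Real.log_le_sub_one_of_pos hw
    push_cast
    linarith
  -- Since `log p ≤ log τ + L`, half of the exponent absorbs `6 log τ` and the other half `2005 n² +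
  -- 6 L`.
  have hhalf1 : 6 * Real.log τ ≤ τ / (2 * (K * n ^ 2)) := by
    rw [le_div_iff₀ (by positivity)]
    calc 6 * Real.log τ * (2 * (K * n ^ 2)) ≤ 6 * (4 * w) * (2 * (K * w ^ 2)) := by
          have : 6 * Real.log τ ≤ 6 * (4 * w) := by linarith
          refine mul_le_mul this ?_ (by positivity) (by positivity)
          gcongr
      _ = (48 * K) * w ^ 3 := by ring
      _ ≤ w * w ^ 3 := by gcongr
      _ = τ := by rw [← hw4]; ring
  have hhalf2 : 2005 * n ^ 2 + 6 * L ≤ τ / (2 * (K * n ^ 2)) := by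
    rw [le_div_iff₀ (by positivity)]
    have h1 : 2005 * (n : ℝ) ^ 2 + 6 * L ≤ 2011 * (n ^ 2 * L) := by
      have a1 : (n : ℝ) ^ 2 ≤ n ^ 2 * L := le_mul_of_one_le_right (by positivity) hL
      have a2 : L ≤ n ^ 2 * L := le_mul_of_one_le_left (by linarith) (one_le_pow₀ hn')
      linarith
    calc (2005 * (n : ℝ) ^ 2 + 6 * L) * (2 * (K * n ^ 2))
        ≤ (2011 * (n ^ 2 * L)) * (2 * (K * n ^ 2)) := by gcongr
      _ = (4022 * K) * (n ^ 4 * L) := by ring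
      _ ≤ (48 * K) ^ 4 * (n ^ 5 * L) := by
          have a1 : (n : ℝ) ^ 4 ≤ n ^ 5 := pow_le_pow_right₀ hn' (by norm_num)
          have a2 : 4022 * K ≤ (48 * K) ^ 4 := by
            have : 4022 * K ≤ (48 * K) ^ 2 := by nlinarith
            exact this.trans (pow_le_pow_right₀ (by linarith) (by norm_num))
          gcongr
      _ ≤ τ := h
  have hsum : τ / (K * n ^ 2) = τ / (2 * (K * n ^ 2)) + τ / (2 * (K * n ^ 2)) := by
    field_simp
    norm_num
  calc Real.exp (2005 * n ^ 2 - τ / (K * n ^ 2)) ≤ Real.exp (-(6 * Real.log p)) := by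
        apply Real.exp_le_exp.2
        rw [hsum]
        linarith
    _ = 1 / (p : ℝ) ^ 6 := by
        rw [Real.exp_neg, one_div]
        congr 1
        rw [← Real.exp_log (pow_pos hp' 6), Real.log_pow]
        norm_num

end

end DictRecovery

end

theorem mainTheorem6 :
    ∃ c : ℝ, 0 < c ∧ ∀ cstar : ℝ, 0 < cstar → ∃ C : ℝ, 0 < C ∧
      ∀ (n p : ℕ) (θ : unitInterval) (μ : ℝ) (A₀ : Matrix (Fin n) (Fin n) ℝ),
        0 < (θ : ℝ) → (θ : ℝ) < 1 / 3 → 0 < μ → μ ≤ 1 → IsUnit A₀ →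
        C / (cstar ^ 2 * (θ : ℝ)) * max ((n : ℝ) ^ 4 / μ ^ 4) ((n : ℝ) ^ 5 / μ ^ 2)
            * DictRecovery.condNumber A₀ ^ 8
            * Real.log (DictRecovery.condNumber A₀ * n / (μ * (θ : ℝ))) ^ 4 ≤ (p : ℝ) →
        ∀ (Ω : Type*) [MeasurableSpace Ω] (P : Measure Ω) [IsProbabilityMeasure P]
          (X₀ : Ω → Matrix (Fin n) (Fin p) ℝ),
          DictRecovery.IsBernoulliGaussian P θ X₀ →
          P {ω | ¬ (IsUnit ((A₀ * X₀ ω) * (A₀ * X₀ ω)ᵀ) ∧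
              ∀ i : Fin n,
                (∃ qstar, DictRecovery.IsTarget
                  (DictRecovery.precond (θ : ℝ) (A₀ * X₀ ω)) (X₀ ω) i qstar) ∧
                ∀ qstar, DictRecovery.IsTarget
                    (DictRecovery.precond (θ : ℝ) (A₀ * X₀ ω)) (X₀ ω) i qstar →
                  ∀ r : EuclideanSpace ℝ (Fin n), ‖r‖ = 1 →
                    249 / 250 ≤ inner ℝ r qstar →
                    DictRecovery.lpSolutions (DictRecovery.precond (θ : ℝ) (A₀ * X₀ ω)) r =
                      {(inner ℝ r qstar)⁻¹ • qstar})}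
            ≤ ENNReal.ofReal (c / (p : ℝ) ^ 6) := by
  -- The factor `cstar ^ 2` cancels the one in the sample size; `2048000000` is the Bernstein rate
  -- constant.
  refine ⟨1, one_pos, fun cstar hc => ⟨(48 * 2048000000) ^ 4 * cstar ^ 2, by positivity, ?_⟩⟩
  intro n p θ μ A₀ hθ hθ3 hμ hμ1 hA hp Ω _ P _ X₀ hX
  rcases Nat.eq_zero_or_pos n with rfl | hn
  · refine le_of_eq_of_le ?_ zero_le
    rw [measure_eq_zero_iff_ae_notMem]
    refine ae_of_all _ fun ω hω => hω ⟨isUnit_of_subsingleton _, fun i => i.elim0⟩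
  have hκ := DictRecovery.one_le_condNumber hn hA
  have hC : (48 * 2048000000) ^ 4 * cstar ^ 2 / (cstar ^ 2 * (θ : ℝ))
      = (48 * 2048000000) ^ 4 / (θ : ℝ) := by
    field_simp
  rw [hC] at hp
  obtain ⟨hL, hτ⟩ := DictRecovery.le_mul_of_sample_size hn (by norm_num) hθ hθ3 hμ hμ1 hκ hp
  have hn' : (1 : ℝ) ≤ n := by exact_mod_cast hn
  have hτ0 : 0 < (θ : ℝ) * p := lt_of_lt_of_le (by positivity) hτ
  have hp1 : 1 ≤ p := by
    rcases Nat.eq_zero_or_pos p with rfl | h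
    · simp at hτ0
    · exact h
  have hlaw := hX.hasLaw
  calc P _ ≤ P ((fun ω k i => X₀ ω i k) ⁻¹' {x | ¬ DictRecovery.GoodColumns (θ * p) x}) := by
        refine measure_mono fun ω hω hgood => hω ?_
        exact DictRecovery.GoodColumns.precond_recovery hτ0 hgood hA
    _ ≤ DictRecovery.columnsLaw n p θ {x | ¬ DictRecovery.GoodColumns (θ * p) x} := by
        rw [← hlaw.map_eq]
        -- This direction holds for arbitrary sets, so no measurability of the bad event is needed.
        exact Measure.le_map_apply hlaw.aemeasurable _
    _ ≤ ENNReal.ofReal (1 / (p : ℝ) ^ 6) := by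
        rw [← ofReal_measureReal]
        exact ENNReal.ofReal_le_ofReal ((DictRecovery.measure_not_goodColumns_le hn hθ3).trans
          (DictRecovery.exp_sub_le_inv_pow hn hp1 (by norm_num) hθ hL hτ))
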